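/- Let $0\le\omega_{\min}<\omega_{\max}<\infty$ and $t_{\max}>0$. Write $\langle f\rangle=\int_{-1}^{1}\int_{\omega_{\min}}^{\omega_{\max}} f\,d\omega\,d\mu$, $g^*(\omega)=\frac{\omega^2e^{\omega}}{(e^{\omega}-1)^2}$, $M=\frac{\omega g^*}{\langle\omega g^*\rangle}$ and $\mathcal L g=-\omega g+M\langle\omega g\rangle$. Let $\phi(\mu,\omega,t)$ (for $\mu>0$) and $\psi(t)$ be essentially bounded, and let $\eta(\omega)$ be measurable with $0\le\eta\le1$. The forward problem, for $t\in[0,t_{\max}]$, $x\in[0,1]$, $\mu\in[-1,1]$, $\omega\in[\omega_{\min},\omega_{\max}]$, is $$\partial_t g+\mu\omega\,\partial_x g=\mathcal L g,\quad g|_{t=0}=0,\quad g|_{x=0}=\phi\ (\mu>0),\quad g(x{=}1,\mu,\omega,t)=\eta(\omega)\,g(x{=}1,-\mu,\omega,t)\ (\mu<0),$$ and the adjoint problem is $$\partial_t h+\mu\omega\,\partial_x h=-\mathcal L h,\quad h|_{t=t_{\max}}=0,\quad h|_{x=0}=\frac{\psi(t)\,g^*(\omega)}{\mu}\ (\mu<0),\quad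 h(x{=}1,\mu,\omega,t)=\eta(\omega)\,h(x{=}1,-\mu,\omega,t)\ (\mu>0).$$ Solutions are jointly measurable and integrable over $(t,x,\mu,\omega)$, and satisfy the equation in integrated form along almost every characteristic line $s\mapsto(s,y+\mu\omega s)$ and the initial (or final) and boundary conditions almost everywhere. The Fréchet derivative of the forward map $\mathcal M(\eta)=\int_0^{t_{\max}}\frac{\langle\omega g\rangle}{\langle\omega g^*\rangle}(x{=}0,t)\,\psi(t)\,dt$ is understood as given by the adjoint formula $$\partial_\eta\mathcal M(\eta)(\omega)=\frac1{\langle\omega g^*\rangle}\int_0^{t_{\max}}\!\!\int_{-1}^0\frac{\mu\,\omega\,h(x{=}1,\mu,\omega,t)\,g(x{=}1,-\mu,\omega,t)}{g^*(\omega)}\,d\mu\,dt ,$$ where $g$ and $h$ solve the forward and the adjoint problem with reflection coefficient $\eta$. Then there is a function $L$ of two real variables, depending only on $\omega_{\min},\omega_{\max},t_{\max}$, such that for all such $\phi,\psi$, all reflection coefficients $\eta_1,\eta_2$ and all corresponding solutions $g_1,g_2$ and $h_1,h_2$, the integral defining $\partial_\eta\mathcal M(\eta_k)(\omega)$ converges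 absolutely for almost every $\omega$, $\partial_\eta\mathcal M(\eta_k)\in L^2(\omega_{\min},\omega_{\max})$ for $k=1,2$, and $$\|\partial_\eta\mathcal M(\eta_1)-\partial_\eta\mathcal M(\eta_2)\|_{2}\le L(\|\phi\|_\infty,\|\psi\|_\infty)\,\|\eta_1-\eta_2\|_{2},$$ where $\|\cdot\|_2$ is the norm of $L^2(\omega_{\min},\omega_{\max})$. -/

import Mathlib

open MeasureTheory Set
open scoped ENNReal

noncomputable section

namespace PhononTransport

/-!
Phonon densities are functions `g t x μ ω` of time `t ∈ [0, tmax]`, position `x ∈ [0, 1]`,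
direction cosine `μ ∈ [-1, 1]` and frequency `ω ∈ [wmin, wmax]`, where `0 ≤ wmin < wmax < ∞`.
-/

/-- Lebesgue measure on the frequency band. -/
def freqMeasure (wmin wmax : ℝ) : Measure ℝ := volume.restrict (Ioo wmin wmax)

/-- Lebesgue measure on the time interval. -/
def timeMeasure (tmax : ℝ) : Measure ℝ := volume.restrict (Ioo 0 tmax)

/-- Lebesgue measure on `(μ, ω) ∈ (-1, 1) × (wmin, wmax)`. -/
def velMeasure (wmin wmax : ℝ) : Measure (ℝ × ℝ) :=
  (volume.restrict (Ioo (-1) 1)).prod (freqMeasure wmin wmax)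

/-- Lebesgue measure on the phase space: `(t, x, μ, ω)`. -/
def phaseMeasure (wmin wmax tmax : ℝ) : Measure (ℝ × ℝ × ℝ × ℝ) :=
  (timeMeasure tmax).prod ((volume.restrict (Ioo 0 1)).prod (velMeasure wmin wmax))

/-- Lebesgue measure on the boundary variables `(t, μ, ω)` with `μ ∈ (0, 1)`. -/
def posBdryMeasure (wmin wmax tmax : ℝ) : Measure (ℝ × ℝ × ℝ) :=
  (timeMeasure tmax).prod ((volume.restrict (Ioo 0 1)).prod (freqMeasure wmin wmax))

/-- Lebesgue measure on the boundary variables `(t, μ, ω)` with `μ ∈ (-1, 0)`. -/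
def negBdryMeasure (wmin wmax tmax : ℝ) : Measure (ℝ × ℝ × ℝ) :=
  (timeMeasure tmax).prod ((volume.restrict (Ioo (-1) 0)).prod (freqMeasure wmin wmax))

/-- The bracket `⟨f⟩ = ∫∫ f(μ, ω) dω dμ`. -/
def bracket (wmin wmax : ℝ) (f : ℝ → ℝ → ℝ) : ℝ :=
  ∫ p, f p.1 p.2 ∂(velMeasure wmin wmax)

/-- The equilibrium `g*(ω) = ω² e^ω / (e^ω - 1)²`. -/
def gStar (ω : ℝ) : ℝ := ω ^ 2 * Real.exp ω / (Real.exp ω - 1) ^ 2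

/-- The normalizing constant `⟨ω g*⟩`. -/
def wgStar (wmin wmax : ℝ) : ℝ := bracket wmin wmax (fun _ ω => ω * gStar ω)

/-- The Maxwellian `M = ω g* / ⟨ω g*⟩`. -/
def maxwellian (wmin wmax : ℝ) (ω : ℝ) : ℝ := ω * gStar ω / wgStar wmin wmax

/-- The linearized BGK collision operator `𝓛 g = -ω g + M ⟨ω g⟩`. -/
def collision (wmin wmax : ℝ) (g : ℝ → ℝ → ℝ → ℝ → ℝ) (t x μ ω : ℝ) : ℝ :=
  -(ω * g t x μ ω) + maxwellian wmin wmax ω * bracket wmin wmax (fun μ' ω' => ω' * g t x μ' ω')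

/-- `g` solves `∂ₜ g + μ ω ∂ₓ g = F` on `[0, tmax] × [0, 1]` along characteristics:
for almost every characteristic line `s ↦ (s, y + μ ω s)`, the restriction of `g` to the part of the
line inside `[0, tmax] × [0, 1]` is absolutely continuous with derivative `F` (that is, it
is the integral of the integrable function `F`). The values `g t 0 μ ω` and `g t 1 μ ω` are thus
the traces of `g`, and `g 0 x μ ω` and `g tmax x μ ω` its initial and final values. -/
def SolvesTransport (wmin wmax tmax : ℝ) (F g : ℝ → ℝ → ℝ → ℝ → ℝ) : Prop :=
  ∀ᵐ q ∂((velMeasure wmin wmax).prod (volume : Measure ℝ)),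
    ∀ s₁ s₂ : ℝ, 0 ≤ s₁ → s₁ ≤ s₂ → s₂ ≤ tmax →
      q.2 + q.1.1 * q.1.2 * s₁ ∈ Icc (0 : ℝ) 1 → q.2 + q.1.1 * q.1.2 * s₂ ∈ Icc (0 : ℝ) 1 →
      IntervalIntegrable (fun s => F s (q.2 + q.1.1 * q.1.2 * s) q.1.1 q.1.2) volume s₁ s₂ ∧
      g s₂ (q.2 + q.1.1 * q.1.2 * s₂) q.1.1 q.1.2 - g s₁ (q.2 + q.1.1 * q.1.2 * s₁) q.1.1 q.1.2
        = ∫ s in s₁..s₂, F s (q.2 + q.1.1 * q.1.2 * s) q.1.1 q.1.2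

/-- Joint measurability and integrability over the phase space. -/
def IsDensity (wmin wmax tmax : ℝ) (g : ℝ → ℝ → ℝ → ℝ → ℝ) : Prop :=
  Measurable (fun p : ℝ × ℝ × ℝ × ℝ => g p.1 p.2.1 p.2.2.1 p.2.2.2) ∧
  Integrable (fun p : ℝ × ℝ × ℝ × ℝ => g p.1 p.2.1 p.2.2.1 p.2.2.2) (phaseMeasure wmin wmax tmax)

/-- `g` solves the forward problem with reflection coefficient `η`, incoming data `φ(t, μ, ω)`
at `x = 0`, and zero initial data. -/
structure IsForwardSolution (wmin wmax tmax : ℝ) (η : ℝ → ℝ) (φ : ℝ → ℝ → ℝ → ℝ)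
    (g : ℝ → ℝ → ℝ → ℝ → ℝ) : Prop where
  density : IsDensity wmin wmax tmax g
  transport : SolvesTransport wmin wmax tmax (collision wmin wmax g) g
  initial : ∀ᵐ p ∂((volume.restrict (Ioo (0 : ℝ) 1)).prod (velMeasure wmin wmax)),
    g 0 p.1 p.2.1 p.2.2 = 0
  incoming : ∀ᵐ p ∂(posBdryMeasure wmin wmax tmax),
    g p.1 0 p.2.1 p.2.2 = φ p.1 p.2.1 p.2.2
  reflection : ∀ᵐ p ∂(negBdryMeasure wmin wmax tmax),
    g p.1 1 p.2.1 p.2.2 = η p.2.2 * g p.1 1 (-p.2.1) p.2.2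

/-- `h` solves the adjoint problem `∂ₜ h + μ ω ∂ₓ h = -𝓛 h` with reflection coefficient `η`,
data `ψ(t) g*(ω) / μ` for `μ < 0` at `x = 0`, and zero final data. -/
structure IsAdjointSolution (wmin wmax tmax : ℝ) (η : ℝ → ℝ) (ψ : ℝ → ℝ)
    (h : ℝ → ℝ → ℝ → ℝ → ℝ) : Prop where
  density : IsDensity wmin wmax tmax h
  transport : SolvesTransport wmin wmax tmax (fun t x μ ω => -collision wmin wmax h t x μ ω) h
  final : ∀ᵐ p ∂((volume.restrict (Ioo (0 : ℝ) 1)).prod (velMeasure wmin wmax)),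
    h tmax p.1 p.2.1 p.2.2 = 0
  incoming : ∀ᵐ p ∂(negBdryMeasure wmin wmax tmax),
    h p.1 0 p.2.1 p.2.2 = ψ p.1 * gStar p.2.2 / p.2.1
  reflection : ∀ᵐ p ∂(posBdryMeasure wmin wmax tmax),
    h p.1 1 p.2.1 p.2.2 = η p.2.2 * h p.1 1 (-p.2.1) p.2.2

/-- Reflection coefficients: measurable functions of the frequency with values in `[0, 1]`. -/
def IsReflection (wmin wmax : ℝ) (η : ℝ → ℝ) : Prop :=
  AEMeasurable η (freqMeasure wmin wmax) ∧
  ∀ᵐ ω ∂(freqMeasure wmin wmax), 0 ≤ η ω ∧ η ω ≤ 1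

/-- Lebesgue measure on `(μ, t) ∈ (-1, 0) × (0, tmax)`. -/
def gradMeasure (tmax : ℝ) : Measure (ℝ × ℝ) :=
  (volume.restrict (Ioo (-1) 0)).prod (timeMeasure tmax)

/-- `μ ω h(x=1, μ, ω, t) g(x=1, -μ, ω, t) / g*(ω)` as a function of `(μ, t)`. -/
def gradIntegrand (g h : ℝ → ℝ → ℝ → ℝ → ℝ) (ω : ℝ) (p : ℝ × ℝ) : ℝ :=
  p.1 * ω * h p.2 1 p.1 ω * g p.2 1 (-p.1) ω / gStar ω

/-- The Fréchet derivative of the forward map, as a function of `ω`, through the forward solution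
`g` and the adjoint solution `h`:
`(1 / ⟨ω g*⟩) ∫_{μ < 0, t} μ ω h(x=1, μ, ω, t) g(x=1, -μ, ω, t) / g*(ω) dμ dt`. -/
def gradient (wmin wmax tmax : ℝ) (g h : ℝ → ℝ → ℝ → ℝ → ℝ) (ω : ℝ) : ℝ :=
  1 / wgStar wmin wmax * ∫ p, gradIntegrand g h ω p ∂(gradMeasure tmax)

/-- The integral over `(μ, t)` in the adjoint formula converges for almost every `ω`, and
the resulting function of `ω` is square integrable. -/
def GradientWellDefined (wmin wmax tmax : ℝ) (g h : ℝ → ℝ → ℝ → ℝ → ℝ) : Prop :=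
  (∀ᵐ ω ∂(freqMeasure wmin wmax), Integrable (gradIntegrand g h ω) (gradMeasure tmax)) ∧
  MemLp (gradient wmin wmax tmax g h) 2 (freqMeasure wmin wmax)

/-- The `L²` norm in frequency (used for square integrable functions only). -/
def normL2 (wmin wmax : ℝ) (f : ℝ → ℝ) : ℝ := (eLpNorm f 2 (freqMeasure wmin wmax)).toReal

/-- Essentially bounded incoming data `φ(t, μ, ω)`, `μ > 0`. -/
def IsBoundedInflow (wmin wmax tmax : ℝ) (φ : ℝ → ℝ → ℝ → ℝ) : Prop :=
  MemLp (fun p : ℝ × ℝ × ℝ => φ p.1 p.2.1 p.2.2) ∞ (posBdryMeasure wmin wmax tmax)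

/-- `‖φ‖_∞` for bounded incoming data. -/
def normInflow (wmin wmax tmax : ℝ) (φ : ℝ → ℝ → ℝ → ℝ) : ℝ :=
  (eLpNorm (fun p : ℝ × ℝ × ℝ => φ p.1 p.2.1 p.2.2) ∞ (posBdryMeasure wmin wmax tmax)).toReal

/-- Essentially bounded test functions `ψ(t)`. -/
def IsBoundedTest (tmax : ℝ) (ψ : ℝ → ℝ) : Prop := MemLp ψ ∞ (timeMeasure tmax)

/-- `‖ψ‖_∞` for bounded test functions. -/
def normTest (tmax : ℝ) (ψ : ℝ → ℝ) : ℝ := (eLpNorm ψ ∞ (timeMeasure tmax)).toReal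

end PhononTransport

end

open MeasureTheory Set
open scoped ENNReal

noncomputable section

namespace PhononTransport

/-! The gradient is a weighted product of two outgoing traces at `x = 1`. Since `h₁ g₁ - h₂ g₂ = h₁
(g₁ - g₂) + g₂ (h₁ - h₂)`, it suffices to have an `L^∞` bound on each trace, and to bound `μ ω`
times the `L¹` norm in time of the trace differences, for almost every `(μ, ω)`, by the `L¹` norm of
`η₁ - η₂`. The weight `μ ω` is already present in the gradient. This controls the difference of the
gradients uniformly in `ω` by the `L¹` norm of `η₁ - η₂`; since the frequency band is bounded, `L²`
norms follow on both sides.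

Time and velocity reversal turns the adjoint problem into a forward problem with inflow of size `1 /
μ`, so both problems fall under `IsTransportSubsolution`. Integration along characteristics, with
one reflection at `x = 1`, bounds the source `ρ = ⟨ω u⟩` by a boundary term plus an integral
operator `scatter` applied to `|ρ|` (`IsTransportSubsolution.extendSource_le`). In `L¹` with weight
`exp (-l t)` this operator has norm of order `1 / l`, so for large `l` it can be absorbed.

For the `L¹` estimate, `g₁ - g₂` has zero inflow and its reflection is contracting up to the error
`(η₁ - η₂) g₂`, which the `L^∞` bound controls (`exists_lintegral_outflow_le`).

For the `L^∞` estimate, the singular inflow makes `ρ` as large as `1 / √x` near `x = 0`. The barrier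
`exp (l t) / √x` is a supersolution for large `l`, because transport along every velocity, however
slow, multiplies it by at most `6 / l` (`transit_barrier_le`). The positive part of `|ρ|` minus a
multiple of the barrier satisfies the homogeneous inequality and hence vanishes by the `L¹`
contraction. The barrier is bounded at `x = 1`, and so is the outgoing trace
(`exists_enorm_outflow_le`). -/

/-! ### Gronwall's inequality on one characteristic, and integrals in one variable. -/

/-- Gronwall applied to `|u|`. The damping sign of `-k u` is not exploited; the resulting factor
`exp (k (b - a))` is harmless on a bounded time interval. -/
theorem enorm_le_of_sub_eq_integral {u q : ℝ → ℝ} {a b k : ℝ} (hab : a ≤ b) (hk : 0 ≤ k)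
    (h : ∀ s ∈ Icc a b, IntervalIntegrable (fun r => -(k * u r) + q r) volume a s ∧
      u s - u a = ∫ r in a..s, (-(k * u r) + q r)) :
    ‖u b‖ₑ ≤ ENNReal.ofReal (Real.exp (k * (b - a))) * (‖u a‖ₑ + ∫⁻ s in Ioc a b, ‖q s‖ₑ) := by
  have hb : b ∈ Icc a b := right_mem_Icc.2 hab
  have hF := (h b hb).1
  have hu : ContinuousOn u (Icc a b) := by
    have h1 : ContinuousOn (fun s => u a + ∫ r in a..s, (-(k * u r) + q r)) (Icc a b) := by
      refine continuousOn_const.add ?_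
      have := intervalIntegral.continuousOn_primitive_interval (μ := volume)
        (f := fun r => -(k * u r) + q r) (a := a) (b := b)
        ((intervalIntegrable_iff' (by simp)).1 hF)
      rwa [uIcc_of_le hab] at this
    refine h1.congr fun s hs => ?_
    have := (h s hs).2
    simp only
    linarith
  -- A globally continuous extension of `u`, so that the primitive of `|U|` is differentiable at
  -- every point, endpoints included.
  set U : ℝ → ℝ := IccExtend hab ((Icc a b).domRestrict u) with hU
  have hUc : Continuous U := (continuousOn_iff_continuous_domRestrict.1 hu).Icc_extend'
  have hUu : ∀ s ∈ Icc a b, U s = u s := fun s hs => by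
    simp [hU, IccExtend_of_mem hab _ hs, Set.domRestrict]
  -- Only the sum `-(k u) + q` is known to be integrable; adding back the continuous `k U` isolates
  -- `q`.
  have hq : IntervalIntegrable q volume a b := by
    have h1 : IntervalIntegrable (fun r => (-(k * u r) + q r) + k * U r) volume a b :=
      hF.add ((continuous_const.mul hUc).intervalIntegrable _ _)
    refine h1.congr ?_
    intro r hr
    rw [uIoc_of_le hab] at hr
    have := hUu r ⟨hr.1.le, hr.2⟩
    simp only [this]
    ring
  set A : ℝ := |u a| + ∫ r in a..b, |q r| with hA
  have hbound : ∀ s ∈ Icc a b, |u s| ≤ A + k * ∫ r in a..s, |U r| := by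
    intro s hs
    have hqs : IntervalIntegrable q volume a s := hq.mono_set (by
      rw [uIcc_of_le hab, uIcc_of_le hs.1]; exact Icc_subset_Icc_right hs.2)
    have e1 : u s = u a + ((∫ r in a..s, q r) - k * ∫ r in a..s, U r) := by
      have h2 := (h s hs).2
      have h3 : ∫ r in a..s, (-(k * u r) + q r) = ∫ r in a..s, (q r - k * U r) := by
        refine intervalIntegral.integral_congr fun r hr => ?_
        rw [uIcc_of_le hs.1] at hr
        have := hUu r ⟨hr.1, hr.2.trans hs.2⟩
        simp only [this]
        ring
      rw [h3, intervalIntegral.integral_sub hqs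
        ((hUc.intervalIntegrable _ _).const_mul k),
        intervalIntegral.integral_const_mul] at h2
      linarith
    have e2 : |∫ r in a..s, q r| ≤ ∫ r in a..b, |q r| := by
      refine (intervalIntegral.abs_integral_le_integral_abs hs.1).trans ?_
      exact intervalIntegral.integral_mono_interval le_rfl hs.1 hs.2
        (Filter.Eventually.of_forall fun r => abs_nonneg _) hq.abs
    have e3 : |∫ r in a..s, U r| ≤ ∫ r in a..s, |U r| :=
      intervalIntegral.abs_integral_le_integral_abs hs.1
    rw [e1]
    have e4 : |k * ∫ r in a..s, U r| ≤ k * ∫ r in a..s, |U r| := by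
      rw [abs_mul, abs_of_nonneg hk]
      exact mul_le_mul_of_nonneg_left e3 hk
    calc |u a + ((∫ r in a..s, q r) - k * ∫ r in a..s, U r)|
        ≤ |u a| + |(∫ r in a..s, q r) - k * ∫ r in a..s, U r| := abs_add_le _ _
      _ ≤ |u a| + (|∫ r in a..s, q r| + |k * ∫ r in a..s, U r|) := by
          gcongr; exact abs_sub _ _
      _ ≤ _ := by rw [hA]; linarith
  have hA0 : 0 ≤ A := add_nonneg (abs_nonneg _)
    (intervalIntegral.integral_nonneg hab fun _ _ => abs_nonneg _)
  have hw0 : ∀ s ∈ Icc a b, 0 ≤ A + k * ∫ r in a..s, |U r| := fun s hs =>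
    (abs_nonneg _).trans (hbound s hs)
  have hderiv : ∀ s, HasDerivAt (fun s => A + k * ∫ r in a..s, |U r|) (k * |U s|) s := fun s =>
    ((intervalIntegral.integral_hasDerivAt_right (hUc.abs.intervalIntegrable _ _)
      hUc.abs.aestronglyMeasurable.stronglyMeasurableAtFilter hUc.abs.continuousAt).const_mul
        k).const_add A
  have hg := norm_le_gronwallBound_of_norm_deriv_right_le (δ := A) (K := k) (ε := 0)
    (a := a) (b := b)
    (fun s _ => (hderiv s).continuousAt.continuousWithinAt)
    (fun s _ => (hderiv s).hasDerivWithinAt) (by simp [abs_of_nonneg hA0])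
    (fun s hs => by
      have hs' : s ∈ Icc a b := ⟨hs.1, hs.2.le⟩
      rw [Real.norm_eq_abs, Real.norm_eq_abs, abs_of_nonneg (hw0 s hs'), add_zero,
        abs_of_nonneg (mul_nonneg hk (abs_nonneg _)), hUu s hs']
      exact mul_le_mul_of_nonneg_left (hbound s hs') hk) b hb
  rw [gronwallBound_ε0, Real.norm_eq_abs, abs_of_nonneg (hw0 b hb)] at hg
  have hfin := (hbound b hb).trans hg
  have hlint : ∫⁻ s in Ioc a b, ‖q s‖ₑ = ENNReal.ofReal (∫ r in a..b, |q r|) := by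
    rw [intervalIntegral.integral_of_le hab,
      ofReal_integral_eq_lintegral_ofReal (hq.abs.1) (ae_of_all _ fun _ => abs_nonneg _)]
    simp [Real.enorm_eq_ofReal_abs]
  rw [hlint, Real.enorm_eq_ofReal_abs, Real.enorm_eq_ofReal_abs,
    ← ENNReal.ofReal_add (abs_nonneg _)
      (intervalIntegral.integral_nonneg hab fun _ _ => abs_nonneg _),
    ← ENNReal.ofReal_mul (Real.exp_nonneg _), mul_comm (Real.exp _)]
  exact ENNReal.ofReal_le_ofReal hfin

theorem ae_comp_affine {a : ℝ} (ha : a ≠ 0) (b : ℝ) {p : ℝ → Prop} (hp : ∀ᵐ t, p t) :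
    ∀ᵐ s : ℝ, p (a * s + b) := by
  have h1 : ∀ᵐ s : ℝ, p (s + b) :=
    (measurePreserving_add_right volume b).quasiMeasurePreserving.ae hp
  have h2 : Measure.QuasiMeasurePreserving (fun s : ℝ => a * s) volume volume := by
    refine ⟨by fun_prop, ?_⟩
    rw [Real.map_volume_mul_left ha]
    exact Measure.smul_absolutelyContinuous
  exact h2.ae h1

theorem lintegral_comp_affine {a : ℝ} (ha : a ≠ 0) (b : ℝ) (f : ℝ → ℝ≥0∞) (hf : Measurable f) :
    ENNReal.ofReal |a| * ∫⁻ s : ℝ, f (a * s + b) = ∫⁻ s, f s := by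
  have h1 : ∫⁻ s : ℝ, f (a * s + b) = ∫⁻ s, f (s + b) ∂(Measure.map (fun x => a * x) volume) := by
    rw [lintegral_map (by fun_prop) (by fun_prop)]
  rw [h1, Real.map_volume_mul_left ha, lintegral_smul_measure, smul_eq_mul, ← mul_assoc,
    ← ENNReal.ofReal_mul (abs_nonneg _), ← abs_mul, mul_inv_cancel₀ ha,
    lintegral_add_right_eq_self]
  simp

theorem setLIntegral_inv_sqrt {X : ℝ} (hX : 0 ≤ X) :
    ∫⁻ s in Ioc 0 X, ENNReal.ofReal (1 / √s) = ENNReal.ofReal (2 * √X) := by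
  have hi : IntervalIntegrable (fun s : ℝ => s ^ (-(1 / 2) : ℝ)) volume 0 X :=
    intervalIntegral.intervalIntegrable_rpow' (by norm_num)
  have h1 : ∀ s ∈ Ioc 0 X, ENNReal.ofReal (1 / √s) = ENNReal.ofReal (s ^ (-(1 / 2) : ℝ)) := by
    intro s hs
    rw [Real.rpow_neg hs.1.le, Real.sqrt_eq_rpow, one_div]
  rw [setLIntegral_congr_fun measurableSet_Ioc h1,
    ← ofReal_integral_eq_lintegral_ofReal hi.1
      ((ae_restrict_iff' measurableSet_Ioc).2 (ae_of_all _ fun s hs => Real.rpow_nonneg hs.1.le _)),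
    ← intervalIntegral.integral_of_le hX, integral_rpow (Or.inl (by norm_num))]
  congr 1
  rw [Real.sqrt_eq_rpow]
  norm_num
  ring

theorem lintegral_exp_neg {l : ℝ} (hl : 0 < l) :
    ∫⁻ s in Ioi (0 : ℝ), ENNReal.ofReal (Real.exp (-(l * s))) = ENNReal.ofReal (1 / l) := by
  have h1 : IntegrableOn (fun s : ℝ => Real.exp (-l * s)) (Ioi 0) := by
    simpa using integrableOn_exp_mul_Ioi (a := -l) (by linarith) 0
  have := integral_exp_mul_Ioi (a := -l) (by linarith) 0
  simp only [← neg_mul]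
  rw [← ofReal_integral_eq_lintegral_ofReal h1 (ae_of_all _ fun _ => Real.exp_nonneg _), this]
  congr 1
  simp [neg_div]

/-! ### Integration along characteristics, the weighted `L¹` norm and the barrier. -/

/-- The integral of `f` backwards in time along the characteristic of speed `v` ending at
`(t, x)`. -/
def transit (v : ℝ) (f : ℝ → ℝ → ℝ≥0∞) (t x : ℝ) : ℝ≥0∞ :=
  ∫⁻ τ in Ioi (0 : ℝ), f (t - τ) (x - v * τ)

/-- The exponentially weighted `L¹` norm of a function of time and position. -/
def weightedMass (l : ℝ) (f : ℝ → ℝ → ℝ≥0∞) : ℝ≥0∞ :=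
  ∫⁻ t, ∫⁻ x, ENNReal.ofReal (Real.exp (-(l * t))) * f t x

/-- A function of time and position that is singular at `x = 0` and, up to a factor which is
small for large `l`, a supersolution for `transit`. -/
def barrier (l t x : ℝ) : ℝ≥0∞ := ENNReal.ofReal (Real.exp (l * t) * (1 / √x))

theorem measurable_curried {α : Type*} [MeasurableSpace α] {f : ℝ → ℝ → ℝ≥0∞}
    (hf : Measurable (Function.uncurry f)) {a b : α → ℝ} (ha : Measurable a) (hb : Measurable b) :
    Measurable fun p => f (a p) (b p) :=
  hf.comp (ha.prodMk hb)

theorem measurable_transit {f : ℝ → ℝ → ℝ≥0∞} (hf : Measurable (Function.uncurry f)) :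
    Measurable fun p : ℝ × ℝ × ℝ => transit p.1 f p.2.1 p.2.2 := by
  unfold transit
  refine Measurable.lintegral_prod_right'
    (f := fun p : (ℝ × ℝ × ℝ) × ℝ => f (p.1.2.1 - p.2) (p.1.2.2 - p.1.1 * p.2)) ?_
  exact measurable_curried hf (by fun_prop) (by fun_prop)

theorem measurable_transit_comp {α : Type*} [MeasurableSpace α] {f : ℝ → ℝ → ℝ≥0∞}
    (hf : Measurable (Function.uncurry f)) {v t x : α → ℝ} (hv : Measurable v) (ht : Measurable t)
    (hx : Measurable x) : Measurable fun p => transit (v p) f (t p) (x p) :=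
  (measurable_transit hf).comp (hv.prodMk (ht.prodMk hx))

theorem transit_mono {v t x : ℝ} {f g : ℝ → ℝ → ℝ≥0∞} (h : ∀ t x, f t x ≤ g t x) :
    transit v f t x ≤ transit v g t x :=
  lintegral_mono fun _ => h _ _

theorem transit_add {v t x : ℝ} {f g : ℝ → ℝ → ℝ≥0∞} (hf : Measurable (Function.uncurry f)) :
    transit v (fun t x => f t x + g t x) t x = transit v f t x + transit v g t x :=
  lintegral_add_left (measurable_curried hf (by fun_prop) (by fun_prop)) _

theorem transit_const_mul {v t x : ℝ} {f : ℝ → ℝ → ℝ≥0∞} (hf : Measurable (Function.uncurry f))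
    (c : ℝ≥0∞) : transit v (fun t x => c * f t x) t x = c * transit v f t x :=
  lintegral_const_mul _ (measurable_curried hf (by fun_prop) (by fun_prop))

/-- The point `(t - s, x - v s)` lies on the backward characteristic through `(t, x)`, so its own
backward integral is a part of the full one. -/
theorem transit_sub_le {v s : ℝ} (hs : 0 ≤ s) (f : ℝ → ℝ → ℝ≥0∞) (t x : ℝ) :
    transit v f (t - s) (x - v * s) ≤ transit v f t x := by
  unfold transit
  rw [← lintegral_indicator measurableSet_Ioi, ← lintegral_indicator measurableSet_Ioi,
    ← lintegral_add_right_eq_self (μ := volume)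
      ((Ioi 0).indicator fun τ => f (t - τ) (x - v * τ)) s]
  refine lintegral_mono fun τ => ?_
  by_cases hτ : 0 < τ
  · have : 0 < τ + s := by linarith
    rw [indicator_of_mem (by exact hτ), indicator_of_mem (by exact this)]
    refine le_of_eq ?_
    congr 1 <;> ring
  · rw [indicator_of_notMem (by exact hτ)]
    exact zero_le

/-- By translation invariance, the shift by `τ` changes the weighted mass exactly by the factor `exp
(-(l τ))`, whose integral over `τ > 0` is `1 / l`. The speed plays no role. -/
theorem weightedMass_transit {l : ℝ} (hl : 0 < l) (v : ℝ) {f : ℝ → ℝ → ℝ≥0∞}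
    (hf : Measurable (Function.uncurry f)) :
    weightedMass l (transit v f) = ENNReal.ofReal (1 / l) * weightedMass l f := by
  have hm1 : ∀ t, Measurable fun x => f t x := fun t =>
    measurable_curried hf (by fun_prop) (by fun_prop)
  have hm2 : Measurable fun t => ∫⁻ x, f t x := Measurable.lintegral_prod_right' hf
  have hm3 : Measurable fun t => ENNReal.ofReal (Real.exp (-(l * t))) * ∫⁻ x, f t x := by
    fun_prop
  have e1 : ∀ t, ∫⁻ x, ENNReal.ofReal (Real.exp (-(l * t))) * transit v f t x =
      ∫⁻ τ in Ioi (0 : ℝ), ENNReal.ofReal (Real.exp (-(l * t))) * ∫⁻ x, f (t - τ) x := by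
    intro t
    rw [lintegral_const_mul _ (measurable_transit_comp hf (by fun_prop) (by fun_prop)
      (by fun_prop))]
    unfold transit
    rw [lintegral_lintegral_swap (f := fun x τ => f (t - τ) (x - v * τ))
      (measurable_curried hf (by fun_prop) (by fun_prop)).aemeasurable,
      ← lintegral_const_mul]
    · exact lintegral_congr fun τ => by
        rw [lintegral_sub_right_eq_self (μ := volume) (fun x => f (t - τ) x) (v * τ)]
    · exact Measurable.lintegral_prod_right' (f := fun p : ℝ × ℝ => f (t - p.1) (p.2 - v * p.1))
        (measurable_curried hf (by fun_prop) (by fun_prop))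
  have e2 : ∀ τ, ∫⁻ t, ENNReal.ofReal (Real.exp (-(l * t))) * ∫⁻ x, f (t - τ) x =
      ENNReal.ofReal (Real.exp (-(l * τ))) *
        ∫⁻ t, ENNReal.ofReal (Real.exp (-(l * t))) * ∫⁻ x, f t x := by
    intro τ
    rw [← lintegral_const_mul _ hm3, ← lintegral_add_right_eq_self (μ := volume) _ τ]
    refine lintegral_congr fun t => ?_
    rw [← mul_assoc, ← ENNReal.ofReal_mul (Real.exp_nonneg _), ← Real.exp_add, add_sub_cancel_right]
    congr 3
    ring
  have e3 : weightedMass l f = ∫⁻ t, ENNReal.ofReal (Real.exp (-(l * t))) * ∫⁻ x, f t x := by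
    unfold weightedMass
    exact lintegral_congr fun t => lintegral_const_mul _ (hm1 t)
  rw [e3, weightedMass]
  simp_rw [e1]
  rw [lintegral_lintegral_swap]
  · simp_rw [e2]
    rw [lintegral_mul_const _ (by fun_prop), lintegral_exp_neg hl]
  · refine Measurable.aemeasurable ?_
    refine Measurable.mul (by fun_prop) ?_
    exact hm2.comp (by fun_prop : Measurable fun p : ℝ × ℝ => p.1 - p.2)

theorem weightedMass_comp_sub (l c : ℝ) (f : ℝ → ℝ → ℝ≥0∞) :
    weightedMass l (fun t x => f t (c - x)) = weightedMass l f := by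
  unfold weightedMass
  exact lintegral_congr fun t => lintegral_sub_left_eq_self
    (fun x => ENNReal.ofReal (Real.exp (-(l * t))) * f t x) c

theorem weightedMass_mono {l : ℝ} {f g : ℝ → ℝ → ℝ≥0∞} (h : ∀ᵐ t, ∀ᵐ x, f t x ≤ g t x) :
    weightedMass l f ≤ weightedMass l g :=
  lintegral_mono_ae (h.mono fun _ ht => lintegral_mono_ae (ht.mono fun _ hx => by gcongr))

theorem weightedMass_add {l : ℝ} {f g : ℝ → ℝ → ℝ≥0∞} (hf : Measurable (Function.uncurry f)) :
    weightedMass l (fun t x => f t x + g t x) = weightedMass l f + weightedMass l g := by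
  unfold weightedMass
  rw [← lintegral_add_left]
  · refine lintegral_congr fun t => ?_
    rw [← lintegral_add_left ((measurable_curried hf (by fun_prop) (by fun_prop)).const_mul _)]
    simp_rw [mul_add]
  · exact Measurable.lintegral_prod_right'
      (f := fun p : ℝ × ℝ => ENNReal.ofReal (Real.exp (-(l * p.1))) * f p.1 p.2)
      (Measurable.mul (by fun_prop) hf)

theorem weightedMass_const_mul {l : ℝ} {f : ℝ → ℝ → ℝ≥0∞} (hf : Measurable (Function.uncurry f))
    (c : ℝ≥0∞) : weightedMass l (fun t x => c * f t x) = c * weightedMass l f := by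
  unfold weightedMass
  rw [← lintegral_const_mul]
  · refine lintegral_congr fun t => ?_
    rw [← lintegral_const_mul _ ((measurable_curried hf (by fun_prop) (by fun_prop)).const_mul _)]
    simp_rw [mul_left_comm]
  · exact Measurable.lintegral_prod_right'
      (f := fun p : ℝ × ℝ => ENNReal.ofReal (Real.exp (-(l * p.1))) * f p.1 p.2)
      (Measurable.mul (by fun_prop) hf)

theorem weightedMass_lintegral {α : Type*} [MeasurableSpace α] {ν : Measure α} [SFinite ν] {l : ℝ}
    {F : α → ℝ → ℝ → ℝ≥0∞} (hF : Measurable fun p : α × ℝ × ℝ => F p.1 p.2.1 p.2.2) :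
    weightedMass l (fun t x => ∫⁻ a, F a t x ∂ν) = ∫⁻ a, weightedMass l (F a) ∂ν := by
  have hW : Measurable fun p : α × ℝ × ℝ =>
      ENNReal.ofReal (Real.exp (-(l * p.2.1))) * F p.1 p.2.1 p.2.2 :=
    Measurable.mul (by fun_prop) hF
  unfold weightedMass
  symm
  rw [lintegral_lintegral_swap]
  · refine lintegral_congr fun t => ?_
    rw [lintegral_lintegral_swap]
    · refine lintegral_congr fun x => ?_
      rw [lintegral_const_mul]
      exact hF.comp (by fun_prop : Measurable fun a : α => (a, t, x))
    · exact (hW.comp (by fun_prop : Measurable fun p : α × ℝ => (p.1, t, p.2))).aemeasurable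
  · exact (Measurable.lintegral_prod_right' (f := fun p : (α × ℝ) × ℝ =>
      ENNReal.ofReal (Real.exp (-(l * p.1.2))) * F p.1.1 p.1.2 p.2)
      (hW.comp (by fun_prop : Measurable fun p : (α × ℝ) × ℝ =>
        (p.1.1, p.1.2, p.2)))).aemeasurable

/-- The map `(t, τ) ↦ (t - τ, y - v τ)` has Jacobian `v` in absolute value. This is how an `L¹`
bound in the interior becomes a bound on traces, at the price of the factor `v`. -/
theorem lintegral_transit_le {v : ℝ} (hv : 0 < v) (y : ℝ) {f : ℝ → ℝ → ℝ≥0∞}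
    (hf : Measurable (Function.uncurry f)) :
    ENNReal.ofReal v * ∫⁻ t, transit v f t y ≤ ∫⁻ t, ∫⁻ x, f t x := by
  have e1 : ∫⁻ t, transit v f t y ≤ ∫⁻ t, ∫⁻ τ, f t (-v * τ + y) := by
    unfold transit
    rw [lintegral_lintegral_swap (f := fun t τ => f (t - τ) (y - v * τ))
      (measurable_curried hf (by fun_prop) (by fun_prop)).aemeasurable]
    rw [lintegral_lintegral_swap (f := fun t τ => f t (-v * τ + y))
      (measurable_curried hf (by fun_prop) (by fun_prop)).aemeasurable]
    refine (setLIntegral_le_lintegral _ _).trans (lintegral_mono fun τ => ?_)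
    rw [lintegral_sub_right_eq_self (μ := volume) (fun t => f t (y - v * τ))]
    refine le_of_eq (lintegral_congr fun t => ?_)
    congr 1
    ring
  calc ENNReal.ofReal v * ∫⁻ t, transit v f t y
      ≤ ENNReal.ofReal v * ∫⁻ t, ∫⁻ τ, f t (-v * τ + y) := by gcongr
    _ = ∫⁻ t, ENNReal.ofReal |-v| * ∫⁻ τ, f t (-v * τ + y) := by
      rw [abs_neg, abs_of_pos hv, lintegral_const_mul]
      exact Measurable.lintegral_prod_right' (f := fun p : ℝ × ℝ => f p.1 (-v * p.2 + y))
        (measurable_curried hf (by fun_prop) (by fun_prop))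
    _ = _ := lintegral_congr fun t => lintegral_comp_affine (neg_ne_zero.2 hv.ne') y (f t)
        (measurable_curried hf (by fun_prop) (by fun_prop))

theorem measurable_barrier (l : ℝ) : Measurable (Function.uncurry (barrier l)) := by
  unfold barrier Function.uncurry
  fun_prop

/-- Going back along a left-moving characteristic increases `x`, where `1 / √x` is smaller; only the
factor `exp (-(l τ))` is left to integrate. -/
theorem transit_neg_barrier_le {l v : ℝ} (hl : 0 < l) (hv : 0 ≤ v) (t : ℝ) {x : ℝ} (hx : 0 < x) :
    transit (-v) (barrier l) t x ≤ ENNReal.ofReal (1 / l) * barrier l t x := by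
  rw [← lintegral_exp_neg hl, ← lintegral_mul_const _ (by fun_prop)]
  refine setLIntegral_mono (by fun_prop) fun τ hτ => ?_
  have hτ' : 0 < τ := hτ
  unfold barrier
  rw [← ENNReal.ofReal_mul (Real.exp_nonneg _), ← mul_assoc, ← Real.exp_add]
  refine ENNReal.ofReal_le_ofReal ?_
  have h1 : l * (t - τ) = -(l * τ) + l * t := by ring
  have h2 : x ≤ x - -v * τ := by nlinarith
  rw [h1]
  gcongr

/-- The characteristic runs back into the singularity, yet the bound must not depend on `v`. On the
half of the path away from `0` the singular factor is at most `2 / √x`, contributing `2 / (l √x)`.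
On the other half `τ > x / (2 v)`, so the exponential is at most `2 v / (l x)`; the factor `v`
cancels the Jacobian in the integral of `1 / √s`, contributing `4 / (l √x)`. -/
theorem transit_barrier_le {l v : ℝ} (hl : 0 < l) (hv : 0 < v) (t : ℝ) {x : ℝ} (hx : 0 < x) :
    transit v (barrier l) t x ≤ ENNReal.ofReal (6 / l) * barrier l t x := by
  have hsx : 0 < √x := Real.sqrt_pos.2 hx
  set G : ℝ → ℝ≥0∞ := (Ioc 0 x).indicator fun s => ENNReal.ofReal (1 / √s) with hG
  have hGm : Measurable G := (by fun_prop : Measurable fun s : ℝ =>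
    ENNReal.ofReal (1 / √s)).indicator measurableSet_Ioc
  have hGi : ENNReal.ofReal v * ∫⁻ τ, G (-v * τ + x) = ENNReal.ofReal (2 * √x) := by
    have := lintegral_comp_affine (neg_ne_zero.2 hv.ne') x G hGm
    rw [abs_neg, abs_of_pos hv, hG, lintegral_indicator measurableSet_Ioc,
      setLIntegral_inv_sqrt hx.le] at this
    exact this
  have hpt : ∀ τ ∈ Ioi (0 : ℝ), barrier l (t - τ) (x - v * τ) ≤
      ENNReal.ofReal (Real.exp (l * t) * (2 / √x)) * ENNReal.ofReal (Real.exp (-(l * τ))) +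
      ENNReal.ofReal (Real.exp (l * t) * (2 / (l * x))) *
        (ENNReal.ofReal v * G (-v * τ + x)) := by
    intro τ hτ
    have hτ' : 0 < τ := hτ
    have hexp : Real.exp (l * (t - τ)) = Real.exp (l * t) * Real.exp (-(l * τ)) := by
      rw [← Real.exp_add]; congr 1; ring
    rcases le_or_gt (v * τ) (x / 2) with h | h
    · refine le_add_right ?_
      unfold barrier
      rw [← ENNReal.ofReal_mul (by positivity), hexp]
      refine ENNReal.ofReal_le_ofReal ?_
      have h1 : √x / 2 ≤ √(x - v * τ) := by
        refine Real.le_sqrt_of_sq_le ?_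
        rw [div_pow, Real.sq_sqrt hx.le]
        linarith
      have h2 : 1 / √(x - v * τ) ≤ 2 / √x := by
        rw [show 2 / √x = 1 / (√x / 2) by field_simp]
        gcongr
      calc Real.exp (l * t) * Real.exp (-(l * τ)) * (1 / √(x - v * τ))
          ≤ Real.exp (l * t) * Real.exp (-(l * τ)) * (2 / √x) := by gcongr
        _ = _ := by ring
    · refine le_add_left ?_
      -- To the left of `0` the barrier vanishes, as the square root is then `0` and `1 / 0 = 0`.
      rcases le_or_gt (x - v * τ) 0 with h0 | h0
      · unfold barrier
        rw [Real.sqrt_eq_zero_of_nonpos h0]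
        simp
      · have hmem : -v * τ + x ∈ Ioc 0 x := ⟨by linarith, by nlinarith⟩
        rw [hG, indicator_of_mem hmem, ← ENNReal.ofReal_mul hv.le,
          ← ENNReal.ofReal_mul (by positivity)]
        unfold barrier
        rw [hexp, show -v * τ + x = x - v * τ by ring]
        refine ENNReal.ofReal_le_ofReal ?_
        have h1 : Real.exp (-(l * τ)) ≤ 2 / (l * x) * v := by
          have h2 : l * τ ≤ Real.exp (l * τ) := by linarith [Real.add_one_le_exp (l * τ)]
          rw [Real.exp_neg, ← one_div]
          calc 1 / Real.exp (l * τ) ≤ 1 / (l * τ) := by gcongr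
            _ ≤ 2 / (l * x) * v := by
              rw [div_mul_eq_mul_div, div_le_div_iff₀ (by positivity) (by positivity)]
              nlinarith
        calc Real.exp (l * t) * Real.exp (-(l * τ)) * (1 / √(x - v * τ))
            ≤ Real.exp (l * t) * (2 / (l * x) * v) * (1 / √(x - v * τ)) := by gcongr
          _ = _ := by ring
  unfold transit
  refine (setLIntegral_mono (by fun_prop) hpt).trans ?_
  rw [lintegral_add_left (by fun_prop), lintegral_const_mul _ (by fun_prop),
    lintegral_exp_neg hl, lintegral_const_mul _ (by fun_prop), lintegral_const_mul _ (by fun_prop)]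
  calc _ ≤ ENNReal.ofReal (Real.exp (l * t) * (2 / √x)) * ENNReal.ofReal (1 / l) +
      ENNReal.ofReal (Real.exp (l * t) * (2 / (l * x))) *
        (ENNReal.ofReal v * ∫⁻ τ, G (-v * τ + x)) := by
        gcongr
        exact Measure.restrict_le_self
    _ = _ := by
        rw [hGi, ← ENNReal.ofReal_mul (by positivity), ← ENNReal.ofReal_mul (by positivity),
          ← ENNReal.ofReal_add (by positivity) (by positivity), barrier,
          ← ENNReal.ofReal_mul (by positivity)]
        congr 1
        have : x = √x * √x := (Real.mul_self_sqrt hx.le).symm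
        have h3 : 2 / (l * x) * (2 * √x) = 4 / (l * √x) := by
          rw [div_mul_eq_mul_div, div_eq_div_iff (by positivity) (by positivity)]
          linear_combination (-4 * l) * this
        calc _ = Real.exp (l * t) * (2 / √x * (1 / l) + 2 / (l * x) * (2 * √x)) := by ring
          _ = _ := by rw [h3]; field_simp; ring

/-! ### Transport at a fixed velocity in the slab, with reflection at `x = 1`. -/

/-- `u` solves `∂ₜ u + v ∂ₓ u = -k u + q` in the slab along almost every characteristic line. -/
def SolvesAlongLines (T v k : ℝ) (q u : ℝ → ℝ → ℝ) : Prop :=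
  ∀ᵐ y : ℝ, ∀ s₁ s₂ : ℝ, 0 ≤ s₁ → s₁ ≤ s₂ → s₂ ≤ T →
    y + v * s₁ ∈ Icc (0 : ℝ) 1 → y + v * s₂ ∈ Icc (0 : ℝ) 1 →
    IntervalIntegrable (fun s => -(k * u s (y + v * s)) + q s (y + v * s)) volume s₁ s₂ ∧
    u s₂ (y + v * s₂) - u s₁ (y + v * s₁)
      = ∫ s in s₁..s₂, (-(k * u s (y + v * s)) + q s (y + v * s))

theorem SolvesAlongLines.flip {T v k : ℝ} {q u : ℝ → ℝ → ℝ} (h : SolvesAlongLines T (-v) k q u) :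
    SolvesAlongLines T v k (fun t x => q t (1 - x)) (fun t x => u t (1 - x)) := by
  have h' := ae_comp_affine (a := -1) (by norm_num) 1 h
  filter_upwards [h'] with y hy s₁ s₂ h0 h12 h2 hm1 hm2
  have e : ∀ s, -1 * y + 1 + -v * s = 1 - (y + v * s) := fun s => by ring
  have := hy s₁ s₂ h0 h12 h2 (by rw [e]; exact ⟨by linarith [hm1.2], by linarith [hm1.1]⟩)
    (by rw [e]; exact ⟨by linarith [hm2.2], by linarith [hm2.1]⟩)
  simpa only [e] using this

theorem transit_flip (v : ℝ) (f : ℝ → ℝ → ℝ≥0∞) (t x : ℝ) :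
    transit v (fun t x => f t (1 - x)) t x = transit (-v) f t (1 - x) := by
  unfold transit
  refine lintegral_congr fun τ => ?_
  change f (t - τ) (1 - (x - v * τ)) = _
  rw [show 1 - (x - v * τ) = 1 - x - -v * τ by ring]

/-- A line starting at `y < 0` enters the slab through `x = 0` at time `-y / v`; one with `y > 0`
starts inside from zero initial data. The line `y = 0` is discarded as a null set. -/
theorem SolvesAlongLines.enorm_le {T v k : ℝ} {q u : ℝ → ℝ → ℝ} (hu : SolvesAlongLines T v k q u)
    (hv : 0 < v) (hk : 0 ≤ k) {f : ℝ → ℝ → ℝ≥0∞} (hf : Measurable (Function.uncurry f))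
    {c : ℝ≥0∞} (hq : ∀ t ∈ Ioo 0 T, ∀ x ∈ Ioo (0 : ℝ) 1, ‖q t x‖ₑ ≤ c * f t x)
    (hinit : ∀ᵐ x : ℝ, x ∈ Ioo (0 : ℝ) 1 → u 0 x = 0) :
    ∀ᵐ y : ℝ, ∀ t ∈ Ioo 0 T, y + v * t ∈ Ioc (0 : ℝ) 1 →
      ‖u t (y + v * t)‖ₑ ≤ ENNReal.ofReal (Real.exp (k * T)) *
        ((if y < 0 then ‖u (-y / v) 0‖ₑ else 0) + c * transit v f t (y + v * t)) := by
  have hne : ∀ᵐ y : ℝ, y ≠ 0 := Measure.ae_ne volume 0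
  filter_upwards [hu, hinit, hne] with y hy hy0 hyne t ht hyt
  have key : ∀ s₀, 0 ≤ s₀ → s₀ ≤ t → y + v * s₀ ∈ Icc (0 : ℝ) 1 → ‖u t (y + v * t)‖ₑ ≤
      ENNReal.ofReal (Real.exp (k * T)) *
        (‖u s₀ (y + v * s₀)‖ₑ + c * transit v f t (y + v * t)) := by
    intro s₀ h0 h1 hm
    have h2 := enorm_le_of_sub_eq_integral (u := fun s => u s (y + v * s))
      (q := fun s => q s (y + v * s)) h1 hk fun s hs =>
        hy s₀ s h0 hs.1 (hs.2.trans ht.2.le) hm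
          ⟨hm.1.trans (by gcongr; exact hs.1), le_trans (by gcongr; exact hs.2) hyt.2⟩
    refine h2.trans ?_
    have h3 : ∫⁻ s in Ioc s₀ t, ‖q s (y + v * s)‖ₑ ≤ c * transit v f t (y + v * t) := by
      have hfm : Measurable fun s => f s (y + v * s) :=
        measurable_curried hf (by fun_prop) (by fun_prop)
      rw [setLIntegral_congr Ioo_ae_eq_Ioc.symm]
      calc ∫⁻ s in Ioo s₀ t, ‖q s (y + v * s)‖ₑ ≤ ∫⁻ s in Ioo s₀ t, c * f s (y + v * s) := by
            refine setLIntegral_mono (hfm.const_mul _) fun s hs => hq s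
              ⟨h0.trans_lt hs.1, hs.2.trans ht.2⟩ _ ⟨?_, ?_⟩
            · exact hm.1.trans_lt (by gcongr; exact hs.1)
            · exact lt_of_lt_of_le (by gcongr; exact hs.2) hyt.2
        _ ≤ ∫⁻ s in Iio t, c * f s (y + v * s) := lintegral_mono_set fun s hs => hs.2
        _ = c * ∫⁻ s in Iio t, f s (y + v * s) := lintegral_const_mul _ hfm
        _ = c * transit v f t (y + v * t) := by
            congr 1
            unfold transit
            rw [← lintegral_indicator measurableSet_Iio, ← lintegral_indicator measurableSet_Ioi,
              ← lintegral_sub_left_eq_self (μ := volume) _ t]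
            refine lintegral_congr fun τ => ?_
            simp only [indicator, mem_Iio, mem_Ioi, sub_lt_self_iff]
            split_ifs
            · congr 1; ring
            · rfl
    have h4 : Real.exp (k * (t - s₀)) ≤ Real.exp (k * T) :=
      Real.exp_le_exp.2 (mul_le_mul_of_nonneg_left (by linarith [ht.2]) hk)
    gcongr
  split_ifs with hy1
  · have hs : y + v * (-y / v) = 0 := by field_simp; ring
    have h1 : -y / v ≤ t := by rw [div_le_iff₀ hv]; linarith [hyt.1]
    have := key (-y / v) (div_nonneg (by linarith) hv.le) h1 (by rw [hs]; simp)
    rwa [hs] at this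
  · have hy2 : 0 < y := lt_of_le_of_ne (not_lt.1 hy1) hyne.symm
    have hy3 : y < 1 := by nlinarith [hyt.2, mul_pos hv ht.1]
    have := key 0 le_rfl ht.1.le (by rw [mul_zero, add_zero]; exact ⟨hy2.le, hy3.le⟩)
    rw [mul_zero, add_zero, hy0 ⟨hy2, hy3⟩, enorm_zero] at this
    exact this

theorem SolvesAlongLines.enorm_le_of_inflow {T v k : ℝ} {q u : ℝ → ℝ → ℝ}
    (hu : SolvesAlongLines T v k q u)
    (hv : 0 < v) (hk : 0 ≤ k) {f : ℝ → ℝ → ℝ≥0∞} (hf : Measurable (Function.uncurry f))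
    {c κ : ℝ≥0∞} (hq : ∀ t ∈ Ioo 0 T, ∀ x ∈ Ioo (0 : ℝ) 1, ‖q t x‖ₑ ≤ c * f t x)
    (hinit : ∀ᵐ x : ℝ, x ∈ Ioo (0 : ℝ) 1 → u 0 x = 0)
    (hin : ∀ᵐ t : ℝ, t ∈ Ioo 0 T → ‖u t 0‖ₑ ≤ κ) :
    ∀ᵐ y : ℝ, ∀ t ∈ Ioo 0 T, y + v * t ∈ Ioc (0 : ℝ) 1 →
      ‖u t (y + v * t)‖ₑ ≤ ENNReal.ofReal (Real.exp (k * T)) *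
        ((if y < 0 then κ else 0) + c * transit v f t (y + v * t)) := by
  have hin' := ae_comp_affine (a := -1 / v) (div_ne_zero (by norm_num) hv.ne') 0 hin
  filter_upwards [hu.enorm_le hv hk hf hq hinit, hin'] with y hy hy' t ht hyt
  refine (hy t ht hyt).trans ?_
  gcongr
  split_ifs with h
  · have e : -1 / v * y + 0 = -y / v := by ring
    rw [e] at hy'
    refine hy' ⟨div_pos (by linarith) hv, lt_of_le_of_lt ?_ ht.2⟩
    rw [div_le_iff₀ hv]
    linarith [hyt.1]
  · exact le_rfl

/-- The outgoing trace at `x = 1`. -/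
theorem SolvesAlongLines.enorm_outflow_le {T v k : ℝ} {q u : ℝ → ℝ → ℝ}
    (hu : SolvesAlongLines T v k q u)
    (hv : 0 < v) (hk : 0 ≤ k) {f : ℝ → ℝ → ℝ≥0∞} (hf : Measurable (Function.uncurry f))
    {c κ : ℝ≥0∞} (hq : ∀ t ∈ Ioo 0 T, ∀ x ∈ Ioo (0 : ℝ) 1, ‖q t x‖ₑ ≤ c * f t x)
    (hinit : ∀ᵐ x : ℝ, x ∈ Ioo (0 : ℝ) 1 → u 0 x = 0)
    (hin : ∀ᵐ t : ℝ, t ∈ Ioo 0 T → ‖u t 0‖ₑ ≤ κ) :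
    ∀ᵐ t : ℝ, t ∈ Ioo 0 T → ‖u t 1‖ₑ ≤ ENNReal.ofReal (Real.exp (k * T)) *
        ((if 1 < v * t then κ else 0) + c * transit v f t 1) := by
  filter_upwards [ae_comp_affine (neg_ne_zero.2 hv.ne') 1
    (hu.enorm_le_of_inflow hv hk hf hq hinit hin)] with t h ht
  have e : -v * t + 1 + v * t = 1 := by ring
  have := h t ht (by rw [e]; simp)
  rw [e] at this
  have e2 : -v * t + 1 < 0 ↔ 1 < v * t := by constructor <;> intro h <;> linarith
  simpa only [e2] using this

/-- The left-moving part `w` is followed back to the wall `x = 1`, and from there along the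
right-moving `u`. Unfolding the slab at the wall places this second leg on the line of speed `v`
through `(t, 2 - x)`. -/
theorem slab_enorm_le {T v k : ℝ} {q u w : ℝ → ℝ → ℝ}
    (hu : SolvesAlongLines T v k q u) (hw : SolvesAlongLines T (-v) k q w)
    (hv : 0 < v) (hk : 0 ≤ k) {f : ℝ → ℝ → ℝ≥0∞} (hf : Measurable (Function.uncurry f))
    {c κ σ : ℝ≥0∞} (hq : ∀ t ∈ Ioo 0 T, ∀ x ∈ Ioo (0 : ℝ) 1, ‖q t x‖ₑ ≤ c * f t x)
    (hinit : ∀ᵐ x : ℝ, x ∈ Ioo (0 : ℝ) 1 → u 0 x = 0)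
    (hinit' : ∀ᵐ x : ℝ, x ∈ Ioo (0 : ℝ) 1 → w 0 x = 0)
    (hin : ∀ᵐ t : ℝ, t ∈ Ioo 0 T → ‖u t 0‖ₑ ≤ κ)
    (hrefl : ∀ᵐ t : ℝ, t ∈ Ioo 0 T → ‖w t 1‖ₑ ≤ ‖u t 1‖ₑ + σ) {t : ℝ} (ht : t ∈ Ioo 0 T) :
    ∀ᵐ x : ℝ, x ∈ Ioo (0 : ℝ) 1 → ‖u t x‖ₑ + ‖w t x‖ₑ ≤
      ENNReal.ofReal (Real.exp (k * T)) ^ 2 *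
        ((if x < v * t then κ else 0) + (if 1 < v * t then κ else 0) + σ +
          c * (transit v f t x + transit v f t (2 - x) + transit (-v) f t x)) := by
  set E := ENNReal.ofReal (Real.exp (k * T)) with hE
  have hE1 : 1 ≤ E := by
    rw [hE, ENNReal.one_le_ofReal, Real.one_le_exp_iff]
    exact mul_nonneg hk (ht.1.trans ht.2).le
  have hpos : ∀ᵐ x : ℝ, x ∈ Ioo (0 : ℝ) 1 →
      ‖u t x‖ₑ ≤ E * ((if x < v * t then κ else 0) + c * transit v f t x) := by
    filter_upwards [ae_comp_affine one_ne_zero (-(v * t))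
      (hu.enorm_le_of_inflow hv hk hf hq hinit hin)] with x h hx
    have e : 1 * x + -(v * t) + v * t = x := by ring
    have := h t ht (by rw [e]; exact ⟨hx.1, hx.2.le⟩)
    rw [e] at this
    have e2 : 1 * x + -(v * t) < 0 ↔ x < v * t := by constructor <;> intro h <;> linarith
    simpa only [e2] using this
  have hbdry : ∀ᵐ s : ℝ, s ∈ Ioo 0 T →
      ‖w s 1‖ₑ ≤ E * ((if 1 < v * s then κ else 0) + c * transit v f s 1) + σ := by
    filter_upwards [hrefl, hu.enorm_outflow_le hv hk hf hq hinit hin] with s h1 h2 hs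
    exact (h1 hs).trans (by gcongr; exact h2 hs)
  have hneg : ∀ᵐ x : ℝ, x ∈ Ioo (0 : ℝ) 1 → ‖w t x‖ₑ ≤
      E * (E * ((if 1 < v * t then κ else 0) + c * transit v f t (2 - x)) + σ +
        c * transit (-v) f t x) := by
    have hf' : Measurable (Function.uncurry fun t x => f t (1 - x)) :=
      measurable_curried hf (by fun_prop) (by fun_prop)
    have hi := ae_comp_affine (a := -1) (by norm_num) 1 hinit'
    have hline := hw.flip.enorm_le hv hk (f := fun t x => f t (1 - x)) (c := c) hf'
      (fun t ht x hx => hq t ht _ ⟨by linarith [hx.2], by linarith [hx.1]⟩)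
      (by
        filter_upwards [hi] with x h hx
        have e : -1 * x + 1 = 1 - x := by ring
        rw [e] at h
        exact h ⟨by linarith [hx.2], by linarith [hx.1]⟩)
    have hb := ae_comp_affine (a := -1 / v) (div_ne_zero (by norm_num) hv.ne') 0 hbdry
    filter_upwards [ae_comp_affine (a := -1) (by norm_num) (1 - v * t) (hline.and hb)]
      with x ⟨h1, h2⟩ hx
    have e : -1 * x + (1 - v * t) + v * t = 1 - x := by ring
    have h3 := h1 t ht (by rw [e]; exact ⟨by linarith [hx.2], by linarith [hx.1]⟩)
    simp only [transit_flip, e, sub_sub_cancel, sub_zero] at h3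
    refine h3.trans ?_
    gcongr
    by_cases h4 : -1 * x + (1 - v * t) < 0
    · rw [if_pos h4]
      -- The time at which the left-moving characteristic through `(t, x)` leaves the wall.
      set s := -(-1 * x + (1 - v * t)) / v with hs
      have e2 : -1 / v * (-1 * x + (1 - v * t)) + 0 = s := by rw [hs]; ring
      rw [e2] at h2
      have hs1 : 0 < s := div_pos (by linarith) hv
      have hs2 : s < t := by rw [hs, div_lt_iff₀ hv]; linarith [hx.2]
      refine (h2 ⟨hs1, hs2.trans ht.2⟩).trans ?_
      have hP : transit v f s 1 ≤ transit v f t (2 - x) := by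
        have := transit_sub_le (v := v) (s := t - s) (by linarith) f t (2 - x)
        have e3 : 2 - x - v * (t - s) = 1 := by rw [hs]; field_simp; ring
        rwa [sub_sub_cancel, e3] at this
      have hI : (if 1 < v * s then κ else 0) ≤ if 1 < v * t then κ else 0 := by
        by_cases a : 1 < v * s
        · rw [if_pos a, if_pos (a.trans (by gcongr))]
        · rw [if_neg a]
          exact zero_le
      gcongr
    · rw [if_neg h4]
      exact zero_le
  filter_upwards [hpos, hneg] with x h1 h2 hx
  -- One factor `E` arises on each of the two legs; since `E ≥ 1`, `E ^ 2` serves for all terms.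
  have hEE : E ≤ E ^ 2 := by rw [sq]; exact le_mul_of_one_le_left' hE1
  have h1' := h1 hx
  have h2' := h2 hx
  set a := if x < v * t then κ else 0
  set b := if 1 < v * t then κ else 0
  set P := transit v f t x
  set Q := transit v f t (2 - x)
  set R := transit (-v) f t x
  calc _ ≤ E * (a + c * P) + E * (E * (b + c * Q) + σ + c * R) := add_le_add h1' h2'
    _ = E * a + E * (c * P) + E ^ 2 * b + E ^ 2 * (c * Q) + E * σ + E * (c * R) := by ring
    _ ≤ E ^ 2 * a + E ^ 2 * (c * P) + E ^ 2 * b + E ^ 2 * (c * Q) + E ^ 2 * σ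
        + E ^ 2 * (c * R) := by gcongr
    _ = _ := by ring

/-! ### Folding the velocity variable to `μ > 0`, and bounds on the equilibrium. -/

/-- Lebesgue measure on `(μ, ω) ∈ (0, 1) × (wmin, wmax)`. -/
def posVelMeasure (wmin wmax : ℝ) : Measure (ℝ × ℝ) :=
  (volume.restrict (Ioo 0 1)).prod (freqMeasure wmin wmax)

instance (wmin wmax : ℝ) : IsFiniteMeasure (freqMeasure wmin wmax) := by
  unfold freqMeasure; infer_instance

instance (tmax : ℝ) : IsFiniteMeasure (timeMeasure tmax) := by
  unfold timeMeasure; infer_instance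

instance (wmin wmax : ℝ) : IsFiniteMeasure (velMeasure wmin wmax) := by
  unfold velMeasure; infer_instance

instance (wmin wmax : ℝ) : IsFiniteMeasure (posVelMeasure wmin wmax) := by
  unfold posVelMeasure; infer_instance

theorem ae_posVelMeasure_mem (wmin wmax : ℝ) :
    ∀ᵐ p ∂posVelMeasure wmin wmax, p.1 ∈ Ioo (0 : ℝ) 1 ∧ p.2 ∈ Ioo wmin wmax := by
  unfold posVelMeasure freqMeasure
  rw [Measure.prod_restrict]
  exact ae_restrict_mem (measurableSet_Ioo.prod measurableSet_Ioo)

theorem ae_velMeasure_mem (wmin wmax : ℝ) : ∀ᵐ p ∂velMeasure wmin wmax, p.2 ∈ Ioo wmin wmax := by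
  unfold velMeasure freqMeasure
  rw [Measure.prod_restrict]
  filter_upwards [ae_restrict_mem (measurableSet_Ioo.prod measurableSet_Ioo)] with p hp
  exact hp.2

theorem posVelMeasure_univ (wmin wmax : ℝ) :
    posVelMeasure wmin wmax univ = ENNReal.ofReal (wmax - wmin) := by
  unfold posVelMeasure freqMeasure
  rw [Measure.prod_restrict, Measure.restrict_apply_univ, Measure.prod_prod]
  simp

theorem velMeasure_eq (wmin wmax : ℝ) : velMeasure wmin wmax = posVelMeasure wmin wmax +
    (posVelMeasure wmin wmax).map (fun p => (-p.1, p.2)) := by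
  have h1 : (volume.restrict (Ioo (-1) 1) : Measure ℝ) =
      volume.restrict (Ioo 0 1) + (volume.restrict (Ioo 0 1)).map (fun x => -x) := by
    have e1 : (volume.restrict (Ioo 0 1) : Measure ℝ).map (fun x => -x) =
        volume.restrict (Ioo (-1) 0) := by
      have := ((Measure.measurePreserving_neg (volume : Measure ℝ)).restrict_preimage
        (s := Ioo (-1 : ℝ) 0) measurableSet_Ioo).map_eq
      simpa using this
    have e2 : (volume.restrict (Ioo (-1) 1) : Measure ℝ) =
        volume.restrict (Ioo (-1) 0 ∪ Ioo 0 1) := by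
      refine Measure.restrict_congr_set ?_
      filter_upwards [Measure.ae_ne volume (0 : ℝ)] with x hx
      refine propext ⟨fun h => ?_, fun h => ?_⟩
      · rcases lt_or_gt_of_ne hx with h0 | h0
        · exact Or.inl ⟨h.1, h0⟩
        · exact Or.inr ⟨h0, h.2⟩
      · rcases h with h | h
        · exact ⟨h.1, h.2.trans one_pos⟩
        · exact ⟨by linarith [h.1], h.2⟩
    rw [e1, e2, Measure.restrict_union _ measurableSet_Ioo, add_comm]
    exact disjoint_left.2 fun x hx hx' => lt_asymm hx.2 hx'.1
  unfold velMeasure posVelMeasure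
  rw [h1, Measure.add_prod]
  congr 1
  have := Measure.map_prod_map (f := fun x : ℝ => -x) (g := fun x : ℝ => x)
    (volume.restrict (Ioo (0 : ℝ) 1)) (freqMeasure wmin wmax) measurable_neg measurable_id
  rw [Measure.map_id'] at this
  exact this

theorem ae_posVelMeasure_of_ae_velMeasure {wmin wmax : ℝ} {P : ℝ × ℝ → Prop}
    (h : ∀ᵐ p ∂velMeasure wmin wmax, P p) :
    ∀ᵐ p ∂posVelMeasure wmin wmax, P p ∧ P (-p.1, p.2) := by
  rw [velMeasure_eq, ae_add_measure_iff] at h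
  exact h.1.and (ae_of_ae_map (by fun_prop) h.2)

theorem lintegral_velMeasure {wmin wmax : ℝ} {F : ℝ × ℝ → ℝ≥0∞} (hF : Measurable F) :
    ∫⁻ p, F p ∂velMeasure wmin wmax =
      ∫⁻ p, (F p + F (-p.1, p.2)) ∂posVelMeasure wmin wmax := by
  rw [velMeasure_eq, lintegral_add_measure, lintegral_map hF (by fun_prop), lintegral_add_left hF]

/-- From `w ≤ exp w - 1`; the companion `le_gStar` uses `exp w - 1 ≤ w exp w`. Thus `gStar` stays
between positive constants down to frequency `0`. -/
theorem gStar_le {w W : ℝ} (hw : 0 < w) (hwW : w ≤ W) : gStar w ≤ Real.exp W := by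
  have h1 : w ≤ Real.exp w - 1 := by linarith [Real.add_one_le_exp w]
  unfold gStar
  rw [div_le_iff₀ (pow_pos (hw.trans_le h1) 2)]
  have h2 : w ^ 2 ≤ (Real.exp w - 1) ^ 2 := by gcongr
  have h3 : Real.exp w ≤ Real.exp W := Real.exp_le_exp.2 hwW
  calc w ^ 2 * Real.exp w ≤ (Real.exp w - 1) ^ 2 * Real.exp W := by gcongr
    _ = _ := by ring

theorem le_gStar {w W : ℝ} (hw : 0 < w) (hwW : w ≤ W) : Real.exp (-W) ≤ gStar w := by
  have h0 : 0 < Real.exp w - 1 := by linarith [Real.add_one_lt_exp hw.ne']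
  have h1 : Real.exp w - 1 ≤ w * Real.exp w := by
    have h2 : -w + 1 ≤ Real.exp (-w) := Real.add_one_le_exp (-w)
    have h3 : Real.exp w * Real.exp (-w) = 1 := by rw [← Real.exp_add]; simp
    nlinarith [Real.exp_pos w]
  unfold gStar
  rw [le_div_iff₀ (by positivity)]
  have h4 : Real.exp (-W) ≤ Real.exp (-w) := Real.exp_le_exp.2 (by linarith)
  calc Real.exp (-W) * (Real.exp w - 1) ^ 2
      ≤ Real.exp (-w) * (w * Real.exp w) ^ 2 := by gcongr
    _ = w ^ 2 * Real.exp w * (Real.exp (-w) * Real.exp w) := by ring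
    _ = _ := by rw [← Real.exp_add]; simp

/-- An upper bound of the Maxwellian. -/
def maxwellianBound (wmin wmax : ℝ) : ℝ≥0∞ :=
  ENNReal.ofReal (wmax * Real.exp wmax / |wgStar wmin wmax|)

theorem enorm_maxwellian_le {wmin wmax w : ℝ} (hwmin : 0 ≤ wmin) (hw : w ∈ Ioo wmin wmax) :
    ‖maxwellian wmin wmax w‖ₑ ≤ maxwellianBound wmin wmax := by
  have hw0 : 0 < w := hwmin.trans_lt hw.1
  have h1 := gStar_le hw0 hw.2.le
  have h2 : 0 ≤ gStar w := (Real.exp_nonneg _).trans (le_gStar hw0 hw.2.le)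
  rw [Real.enorm_eq_ofReal_abs, maxwellianBound, maxwellian, abs_div, abs_mul, abs_of_pos hw0,
    abs_of_nonneg h2]
  refine ENNReal.ofReal_le_ofReal ?_
  have := hw.2.le
  have : 0 ≤ wmax := hw0.le.trans this
  gcongr

/-! ### The integral inequality for the source. -/

/-- `u` solves a transport problem with source `M ρ`, where `|ρ| ≤ ⟨ω |u|⟩`, with vanishing initial
data, inflow bounded by `K / μ`, and reflection at `x = 1` that is contracting up to an
error `σ`. -/
structure IsTransportSubsolution (wmin wmax T : ℝ) (K : ℝ≥0∞) (σ : ℝ → ℝ≥0∞) (ρ : ℝ → ℝ → ℝ)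
    (u : ℝ → ℝ → ℝ → ℝ → ℝ) : Prop where
  density : IsDensity wmin wmax T u
  measurable_source : Measurable (Function.uncurry ρ)
  source_le : ∀ᵐ t, ∀ᵐ x, t ∈ Ioo 0 T → x ∈ Ioo (0 : ℝ) 1 →
    ‖ρ t x‖ₑ ≤ ∫⁻ p, ‖p.2 * u t x p.1 p.2‖ₑ ∂velMeasure wmin wmax
  lines : ∀ᵐ p ∂velMeasure wmin wmax, SolvesAlongLines T (p.1 * p.2) p.2
    (fun t x => maxwellian wmin wmax p.2 * ρ t x) (fun t x => u t x p.1 p.2)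
  initial : ∀ᵐ p ∂velMeasure wmin wmax, ∀ᵐ x, x ∈ Ioo (0 : ℝ) 1 → u 0 x p.1 p.2 = 0
  inflow : ∀ᵐ p ∂posVelMeasure wmin wmax, ∀ᵐ t, t ∈ Ioo 0 T →
    ‖u t 0 p.1 p.2‖ₑ ≤ K * ENNReal.ofReal (1 / p.1)
  reflection : ∀ᵐ p ∂posVelMeasure wmin wmax, ∀ᵐ t, t ∈ Ioo 0 T →
    ‖u t 1 (-p.1) p.2‖ₑ ≤ ‖u t 1 p.1 p.2‖ₑ + σ p.2

/-- The extension of `|ρ|` by zero outside of `(0, T) × (0, 1)`. -/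
def extendSource (T : ℝ) (ρ : ℝ → ℝ → ℝ) (t x : ℝ) : ℝ≥0∞ :=
  (Ioo 0 T ×ˢ Ioo (0 : ℝ) 1).indicator (fun p => ‖ρ p.1 p.2‖ₑ) (t, x)

theorem extendSource_of_mem {T : ℝ} {ρ : ℝ → ℝ → ℝ} {t x : ℝ} (ht : t ∈ Ioo 0 T)
    (hx : x ∈ Ioo (0 : ℝ) 1) : extendSource T ρ t x = ‖ρ t x‖ₑ :=
  indicator_of_mem (show (t, x) ∈ Ioo 0 T ×ˢ Ioo (0 : ℝ) 1 from ⟨ht, hx⟩) _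

theorem extendSource_of_notMem {T : ℝ} {ρ : ℝ → ℝ → ℝ} {t x : ℝ}
    (h : ¬(t ∈ Ioo 0 T ∧ x ∈ Ioo (0 : ℝ) 1)) : extendSource T ρ t x = 0 :=
  indicator_of_notMem (show (t, x) ∉ Ioo 0 T ×ˢ Ioo (0 : ℝ) 1 from h) _

theorem measurable_extendSource {T : ℝ} {ρ : ℝ → ℝ → ℝ} (hρ : Measurable (Function.uncurry ρ)) :
    Measurable (Function.uncurry (extendSource T ρ)) := by
  unfold extendSource Function.uncurry
  exact (hρ.enorm).indicator (measurableSet_Ioo.prod measurableSet_Ioo)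

/-- The contribution of the boundary data to the density. -/
def boundarySource (wmin wmax : ℝ) (K : ℝ≥0∞) (σ : ℝ → ℝ≥0∞) (t x : ℝ) : ℝ≥0∞ :=
  ∫⁻ p, ((if x < p.1 * p.2 * t then K * ENNReal.ofReal (1 / p.1) else 0) +
    (if 1 < p.1 * p.2 * t then K * ENNReal.ofReal (1 / p.1) else 0) + σ p.2)
    ∂posVelMeasure wmin wmax

/-- The contribution of scattering to the density, along all backward characteristics. -/
def scatter (wmin wmax : ℝ) (f : ℝ → ℝ → ℝ≥0∞) (t x : ℝ) : ℝ≥0∞ :=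
  ∫⁻ p, (transit (p.1 * p.2) f t x + transit (p.1 * p.2) f t (2 - x) +
    transit (-(p.1 * p.2)) f t x) ∂posVelMeasure wmin wmax

theorem ofReal_exp_mul_le {k W T : ℝ} (hk : k ≤ W) (hT : 0 ≤ T) :
    ENNReal.ofReal (Real.exp (k * T)) ≤ ENNReal.ofReal (Real.exp (W * T)) :=
  ENNReal.ofReal_le_ofReal (Real.exp_le_exp.2 (by gcongr))

/-- The constant in front of the source terms in the integral inequality for the density. -/
def growthFactor (wmax T : ℝ) : ℝ≥0∞ :=
  ENNReal.ofReal wmax * ENNReal.ofReal (Real.exp (wmax * T)) ^ 2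

theorem IsTransportSubsolution.extendSource_le {wmin wmax T : ℝ} {K : ℝ≥0∞} {σ : ℝ → ℝ≥0∞}
    {ρ : ℝ → ℝ → ℝ} {u : ℝ → ℝ → ℝ → ℝ → ℝ} (hwmin : 0 ≤ wmin) (hσ : Measurable σ)
    (h : IsTransportSubsolution wmin wmax T K σ ρ u) :
    ∀ᵐ t, ∀ᵐ x, t ∈ Ioo 0 T → x ∈ Ioo (0 : ℝ) 1 → extendSource T ρ t x ≤
      growthFactor wmax T * boundarySource wmin wmax K σ t x +
      growthFactor wmax T * maxwellianBound wmin wmax *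
        scatter wmin wmax (extendSource T ρ) t x := by
  set f := extendSource T ρ with hf
  have hfm : Measurable (Function.uncurry f) := measurable_extendSource h.measurable_source
  set E := ENNReal.ofReal (Real.exp (wmax * T)) with hE
  set c := maxwellianBound wmin wmax with hc
  have hum := h.density.1
  have hp : ∀ᵐ p ∂posVelMeasure wmin wmax, ∀ t ∈ Ioo 0 T,
      ∀ᵐ x ∂(volume.restrict (Ioo (0 : ℝ) 1)),
      ‖u t x p.1 p.2‖ₑ + ‖u t x (-p.1) p.2‖ₑ ≤ E ^ 2 *
        ((if x < p.1 * p.2 * t then K * ENNReal.ofReal (1 / p.1) else 0) +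
        (if 1 < p.1 * p.2 * t then K * ENNReal.ofReal (1 / p.1) else 0) + σ p.2 +
        c * (transit (p.1 * p.2) f t x + transit (p.1 * p.2) f t (2 - x) +
          transit (-(p.1 * p.2)) f t x)) := by
    filter_upwards [ae_posVelMeasure_of_ae_velMeasure h.lines, ae_posVelMeasure_of_ae_velMeasure h.initial, h.inflow, h.reflection,
      ae_posVelMeasure_mem wmin wmax] with p hl hi hin hr hm t ht
    have hw0 : 0 < p.2 := hwmin.trans_lt hm.2.1
    have hl2 := hl.2
    simp only [neg_mul] at hl2
    rw [ae_restrict_iff' measurableSet_Ioo]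
    filter_upwards [slab_enorm_le (c := c) (f := f) hl.1 hl2 (mul_pos hm.1.1 hw0) hw0.le hfm
      (fun t ht x hx => by
        rw [hf, extendSource_of_mem ht hx, enorm_mul]
        gcongr
        exact enorm_maxwellian_le hwmin hm.2) hi.1 hi.2 hin hr ht] with x hx hx1
    refine (hx hx1).trans ?_
    gcongr
    exact ofReal_exp_mul_le hm.2.2.le (ht.1.trans ht.2).le
  filter_upwards [h.source_le] with t hρ
  by_cases ht : t ∈ Ioo 0 T
  swap
  · exact ae_of_all _ fun x ht' => absurd ht' ht
  have hmeas : Measurable fun z : (ℝ × ℝ) × ℝ =>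
      ((if z.2 < z.1.1 * z.1.2 * t then K * ENNReal.ofReal (1 / z.1.1) else 0) +
        (if 1 < z.1.1 * z.1.2 * t then K * ENNReal.ofReal (1 / z.1.1) else 0) + σ z.1.2) := by
    refine Measurable.add (Measurable.add ?_ ?_) (hσ.comp (by fun_prop))
    · exact Measurable.ite (measurableSet_lt (by fun_prop) (by fun_prop)) (by fun_prop)
        (by fun_prop)
    · exact Measurable.ite (measurableSet_lt (by fun_prop) (by fun_prop)) (by fun_prop)
        (by fun_prop)
  have hmeas' : Measurable fun z : (ℝ × ℝ) × ℝ =>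
      (transit (z.1.1 * z.1.2) f t z.2 + transit (z.1.1 * z.1.2) f t (2 - z.2) +
          transit (-(z.1.1 * z.1.2)) f t z.2) :=
    ((measurable_transit_comp hfm (by fun_prop) (by fun_prop) (by fun_prop)).add
      (measurable_transit_comp hfm (by fun_prop) (by fun_prop) (by fun_prop))).add
      (measurable_transit_comp hfm (by fun_prop) (by fun_prop) (by fun_prop))
  have hmeasu : Measurable fun z : (ℝ × ℝ) × ℝ =>
      ‖u t z.2 z.1.1 z.1.2‖ₑ + ‖u t z.2 (-z.1.1) z.1.2‖ₑ :=
    (hum.comp (by fun_prop : Measurable fun z : (ℝ × ℝ) × ℝ => (t, z.2, z.1.1, z.1.2))).enorm.add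
      (hum.comp (by fun_prop : Measurable fun z : (ℝ × ℝ) × ℝ => (t, z.2, -z.1.1, z.1.2))).enorm
  -- The estimate holds for almost every velocity and then almost every `x`; integrating over
  -- velocities at fixed `x` requires the opposite order, hence the measurability of both sides.
  have hswap := hp.mono fun p hp => hp t ht
  rw [Measure.ae_ae_comm] at hswap
  swap
  · exact measurableSet_le hmeasu ((hmeas.add (hmeas'.const_mul c)).const_mul (E ^ 2))
  rw [ae_restrict_iff' measurableSet_Ioo] at hswap
  filter_upwards [hswap, hρ] with x hx hρx _ hx1
  have hx2 := hx hx1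
  rw [hf, extendSource_of_mem ht hx1, ← hf]
  refine (hρx ht hx1).trans ?_
  have hum' : Measurable fun p : ℝ × ℝ => ‖p.2 * u t x p.1 p.2‖ₑ :=
    (Measurable.mul (by fun_prop) (hum.comp (by fun_prop : Measurable fun z : ℝ × ℝ =>
      (t, x, z.1, z.2)))).enorm
  rw [lintegral_velMeasure hum']
  have hm1 := hmeas.comp (by fun_prop : Measurable fun p : ℝ × ℝ => (p, x))
  have hm2 := hmeas'.comp (by fun_prop : Measurable fun p : ℝ × ℝ => (p, x))
  simp only [Function.comp_def] at hm1 hm2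
  unfold boundarySource scatter growthFactor
  rw [← hE, mul_assoc (ENNReal.ofReal wmax * E ^ 2), ← mul_add, ← lintegral_const_mul c hm2,
    ← lintegral_add_left hm1]
  refine le_trans ?_ (lintegral_const_mul _ (hm1.add (hm2.const_mul c))).le
  refine lintegral_mono_ae ?_
  filter_upwards [hx2, ae_posVelMeasure_mem wmin wmax] with p h1 hm
  have hw0 : 0 < p.2 := hwmin.trans_lt hm.2.1
  rw [enorm_mul, enorm_mul, ← mul_add, mul_assoc]
  refine mul_le_mul' ?_ h1
  rw [Real.enorm_eq_ofReal hw0.le]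
  exact ENNReal.ofReal_le_ofReal hm.2.2.le

theorem IsTransportSubsolution.enorm_outflow_le {wmin wmax T : ℝ} {K : ℝ≥0∞} {σ : ℝ → ℝ≥0∞}
    {ρ : ℝ → ℝ → ℝ} {u : ℝ → ℝ → ℝ → ℝ → ℝ} (hwmin : 0 ≤ wmin)
    (h : IsTransportSubsolution wmin wmax T K σ ρ u) :
    ∀ᵐ p ∂posVelMeasure wmin wmax, ∀ᵐ t, t ∈ Ioo 0 T → ‖u t 1 p.1 p.2‖ₑ ≤
      ENNReal.ofReal (Real.exp (wmax * T)) *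
        ((if 1 < p.1 * p.2 * t then K * ENNReal.ofReal (1 / p.1) else 0) +
          maxwellianBound wmin wmax * transit (p.1 * p.2) (extendSource T ρ) t 1) := by
  filter_upwards [ae_posVelMeasure_of_ae_velMeasure h.lines, ae_posVelMeasure_of_ae_velMeasure h.initial, h.inflow,
      ae_posVelMeasure_mem wmin wmax] with p hl hi hin hm
  have hw0 : 0 < p.2 := hwmin.trans_lt hm.2.1
  filter_upwards [hl.1.enorm_outflow_le (c := maxwellianBound wmin wmax) (mul_pos hm.1.1 hw0) hw0.le
    (measurable_extendSource (T := T) h.measurable_source) (fun t ht x hx => by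
        rw [extendSource_of_mem ht hx, enorm_mul]
        gcongr
        exact enorm_maxwellian_le hwmin hm.2) hi.1 hin] with t h1 ht
  refine (h1 ht).trans ?_
  have := ofReal_exp_mul_le hm.2.2.le (ht.1.trans ht.2).le
  gcongr

/-! ### Smallness of the scattering operator for large rates, and absorption. -/

theorem measurable_scatter {f : ℝ → ℝ → ℝ≥0∞}
    (hf : Measurable (Function.uncurry f)) :
    Measurable fun z : (ℝ × ℝ) × ℝ × ℝ =>
      (transit (z.1.1 * z.1.2) f z.2.1 z.2.2 + transit (z.1.1 * z.1.2) f z.2.1 (2 - z.2.2) +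
          transit (-(z.1.1 * z.1.2)) f z.2.1 z.2.2) :=
    ((measurable_transit_comp hf (by fun_prop) (by fun_prop) (by fun_prop)).add
      (measurable_transit_comp hf (by fun_prop) (by fun_prop) (by fun_prop))).add
      (measurable_transit_comp hf (by fun_prop) (by fun_prop) (by fun_prop))

theorem weightedMass_scatter {wmin wmax l : ℝ} (hl : 0 < l) {f : ℝ → ℝ → ℝ≥0∞}
    (hf : Measurable (Function.uncurry f)) :
    weightedMass l (scatter wmin wmax f) =
      3 * (ENNReal.ofReal (wmax - wmin) * ENNReal.ofReal (1 / l)) * weightedMass l f := by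
  unfold scatter
  rw [weightedMass_lintegral (F := fun (p : ℝ × ℝ) t x => transit (p.1 * p.2) f t x +
    transit (p.1 * p.2) f t (2 - x) + transit (-(p.1 * p.2)) f t x) (measurable_scatter hf)]
  have e : ∀ p : ℝ × ℝ, weightedMass l (fun t x => transit (p.1 * p.2) f t x +
      transit (p.1 * p.2) f t (2 - x) + transit (-(p.1 * p.2)) f t x) =
      3 * (ENNReal.ofReal (1 / l) * weightedMass l f) := by
    intro p
    rw [weightedMass_add, weightedMass_add,
      weightedMass_comp_sub l 2 (transit (p.1 * p.2) f), weightedMass_transit hl _ hf,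
      weightedMass_transit hl _ hf]
    · ring
    · exact measurable_transit_comp hf (by fun_prop) (by fun_prop) (by fun_prop)
    · exact (measurable_transit_comp hf (by fun_prop) (by fun_prop) (by fun_prop)).add
        (measurable_transit_comp hf (by fun_prop) (by fun_prop) (by fun_prop))
  simp_rw [e]
  rw [lintegral_const, posVelMeasure_univ]
  ring

theorem scatter_add {wmin wmax : ℝ} {f g : ℝ → ℝ → ℝ≥0∞} (hf : Measurable (Function.uncurry f))
    (t x : ℝ) : scatter wmin wmax (fun t x => f t x + g t x) t x =
      scatter wmin wmax f t x + scatter wmin wmax g t x := by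
  have hm := (measurable_scatter hf).comp
    (by fun_prop : Measurable fun p : ℝ × ℝ => (p, t, x))
  simp only [Function.comp_def] at hm
  unfold scatter
  rw [← lintegral_add_left hm]
  refine lintegral_congr fun p => ?_
  rw [transit_add hf, transit_add hf, transit_add hf]
  ring

theorem scatter_mono {wmin wmax t x : ℝ} {f g : ℝ → ℝ → ℝ≥0∞} (h : ∀ t x, f t x ≤ g t x) :
    scatter wmin wmax f t x ≤ scatter wmin wmax g t x :=
  lintegral_mono fun _ => by
    gcongr <;> exact transit_mono h

/-- The constant `18` is three transits with `6 / l` each. The unfolded one, evaluated at `2 - x ≥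
x`, is covered because the barrier decreases in `x`. -/
theorem scatter_barrier_le {wmin wmax l : ℝ} (hwmin : 0 ≤ wmin) (hl : 0 < l) (t : ℝ) {x : ℝ}
    (hx : x ∈ Ioo (0 : ℝ) 1) (B : ℝ≥0∞) :
    scatter wmin wmax (fun t x => B * barrier l t x) t x ≤
      18 * (ENNReal.ofReal (wmax - wmin) * ENNReal.ofReal (1 / l)) * (B * barrier l t x) := by
  have h6 : ENNReal.ofReal (6 / l) = 6 * ENNReal.ofReal (1 / l) := by
    rw [show (6 : ℝ) / l = 6 * (1 / l) by ring, ENNReal.ofReal_mul (by norm_num)]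
    norm_num
  have hb : barrier l t (2 - x) ≤ barrier l t x := by
    unfold barrier
    have := hx.1
    have : x ≤ 2 - x := by linarith [hx.2]
    gcongr
  have : ∀ p : ℝ × ℝ, p.1 ∈ Ioo (0 : ℝ) 1 ∧ p.2 ∈ Ioo wmin wmax →
      (transit (p.1 * p.2) (fun t x => B * barrier l t x) t x +
      transit (p.1 * p.2) (fun t x => B * barrier l t x) t (2 - x) +
      transit (-(p.1 * p.2)) (fun t x => B * barrier l t x) t x) ≤
      18 * (ENNReal.ofReal (1 / l) * (B * barrier l t x)) := by
    intro p hm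
    have hv : 0 < p.1 * p.2 := mul_pos hm.1.1 (hwmin.trans_lt hm.2.1)
    rw [transit_const_mul (measurable_barrier l), transit_const_mul (measurable_barrier l),
      transit_const_mul (measurable_barrier l), ← mul_add, ← mul_add]
    have h1 := transit_barrier_le hl hv t hx.1
    have h2 := (transit_barrier_le hl hv t (x := 2 - x) (by linarith [hx.2])).trans
      (mul_le_mul_right hb _)
    have h3 : transit (-(p.1 * p.2)) (barrier l) t x ≤ ENNReal.ofReal (6 / l) * barrier l t x := by
      refine (transit_neg_barrier_le hl hv.le t hx.1).trans ?_
      gcongr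
      norm_num
    calc _ ≤ B * (ENNReal.ofReal (6 / l) * barrier l t x + ENNReal.ofReal (6 / l) * barrier l t x +
          ENNReal.ofReal (6 / l) * barrier l t x) := by gcongr
      _ = _ := by rw [h6]; ring
  unfold scatter
  refine (lintegral_mono_ae ((ae_posVelMeasure_mem wmin wmax).mono this)).trans (le_of_eq ?_)
  rw [lintegral_const, posVelMeasure_univ]
  ring

theorem le_two_mul_of_le_add_mul {a b c : ℝ≥0∞} (ha : a ≠ ∞) (hc : c ≤ 2⁻¹) (h : a ≤ b + c * a) :
    a ≤ 2 * b := by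
  have h1 : a ≤ b + 2⁻¹ * a := h.trans (by gcongr)
  have h2 : 2⁻¹ * a + 2⁻¹ * a = a := by
    rw [← add_mul, ENNReal.inv_two_add_inv_two, one_mul]
  have h3 : 2⁻¹ * a ≤ b := by
    refine (ENNReal.add_le_add_iff_right (a := 2⁻¹ * a) ?_).1 (by rwa [h2])
    exact ENNReal.mul_ne_top (by simp) ha
  calc a = 2 * (2⁻¹ * a) := by
        rw [← mul_assoc, ENNReal.mul_inv_cancel (by simp) (by simp), one_mul]
    _ ≤ 2 * b := by gcongr

theorem exists_rate {c : ℝ≥0∞} (hc : c ≠ ∞) :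
    ∃ l : ℝ, 0 < l ∧ c * ENNReal.ofReal (1 / l) ≤ 2⁻¹ := by
  have h0 : 0 ≤ c.toReal := ENNReal.toReal_nonneg
  refine ⟨2 * c.toReal + 1, by positivity, ?_⟩
  rw [← ENNReal.ofReal_toReal hc, ← ENNReal.ofReal_mul h0, ENNReal.toReal_ofReal h0,
    show (2⁻¹ : ℝ≥0∞) = ENNReal.ofReal 2⁻¹ by rw [ENNReal.ofReal_inv_of_pos two_pos]; simp]
  refine ENNReal.ofReal_le_ofReal ?_
  rw [mul_one_div, div_le_iff₀ (by positivity)]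
  linarith

/-- On `(0, T)` the weight lies between `exp (-(l T))` and `1`. This lemma and
`lintegral_le_weightedMass` pass between weighted and unweighted integrals of functions supported in
the box. -/
theorem weightedMass_le_of_box {l T : ℝ} (hl : 0 ≤ l) {f G : ℝ → ℝ → ℝ≥0∞}
    (h : ∀ᵐ t, ∀ᵐ x, t ∈ Ioo 0 T → x ∈ Ioo (0 : ℝ) 1 → f t x ≤ G t x)
    (h0 : ∀ t x, ¬(t ∈ Ioo 0 T ∧ x ∈ Ioo (0 : ℝ) 1) → f t x = 0) :
    weightedMass l f ≤ ∫⁻ t in Ioo 0 T, ∫⁻ x in Ioo (0 : ℝ) 1, G t x := by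
  unfold weightedMass
  rw [← lintegral_indicator measurableSet_Ioo]
  refine lintegral_mono_ae (h.mono fun t ht => ?_)
  by_cases hT : t ∈ Ioo 0 T
  · rw [indicator_of_mem hT, ← lintegral_indicator measurableSet_Ioo]
    refine lintegral_mono_ae (ht.mono fun x hx => ?_)
    by_cases hX : x ∈ Ioo (0 : ℝ) 1
    · rw [indicator_of_mem hX]
      refine le_trans ?_ (hx hT hX)
      refine mul_le_of_le_one_left' ?_
      rw [ENNReal.ofReal_le_one, Real.exp_le_one_iff, neg_nonpos]
      exact mul_nonneg hl hT.1.le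
    · rw [h0 t x fun hh => hX hh.2]
      simp
  · simp [h0 t _ fun hh => hT hh.1]

theorem lintegral_le_weightedMass {l T : ℝ} (hl : 0 ≤ l) {f : ℝ → ℝ → ℝ≥0∞}
    (h0 : ∀ t x, ¬(t ∈ Ioo 0 T ∧ x ∈ Ioo (0 : ℝ) 1) → f t x = 0) :
    ∫⁻ t, ∫⁻ x, f t x ≤ ENNReal.ofReal (Real.exp (l * T)) * weightedMass l f := by
  unfold weightedMass
  rw [← lintegral_const_mul' _ _ ENNReal.ofReal_ne_top]
  refine lintegral_mono fun t => ?_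
  rw [← lintegral_const_mul' _ _ ENNReal.ofReal_ne_top]
  refine lintegral_mono fun x => ?_
  by_cases h : t ∈ Ioo 0 T ∧ x ∈ Ioo (0 : ℝ) 1
  · rw [← mul_assoc, ← ENNReal.ofReal_mul (Real.exp_nonneg _), ← Real.exp_add]
    refine le_mul_of_one_le_left' ?_
    rw [ENNReal.one_le_ofReal, Real.one_le_exp_iff]
    nlinarith [h.1.2]
  · rw [h0 t x h]
    exact zero_le

/-- Finiteness is what makes absorption legitimate; it comes from the integrability of the density
over phase space and the boundedness of `ω`. -/
theorem IsTransportSubsolution.weightedMass_ne_top {wmin wmax T l : ℝ} {K : ℝ≥0∞} {σ : ℝ → ℝ≥0∞}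
    {ρ : ℝ → ℝ → ℝ} {u : ℝ → ℝ → ℝ → ℝ → ℝ} (hwmin : 0 ≤ wmin) (hl : 0 ≤ l)
    (h : IsTransportSubsolution wmin wmax T K σ ρ u) :
    weightedMass l (extendSource T ρ) ≠ ∞ := by
  have h1 : weightedMass l (extendSource T ρ) ≤ ∫⁻ t in Ioo 0 T, ∫⁻ x in Ioo (0 : ℝ) 1,
      ENNReal.ofReal wmax * ∫⁻ p, ‖u t x p.1 p.2‖ₑ ∂velMeasure wmin wmax := by
    refine weightedMass_le_of_box hl ?_ fun t x => extendSource_of_notMem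
    filter_upwards [h.source_le] with t ht
    filter_upwards [ht] with x hx hT hX
    rw [extendSource_of_mem hT hX, ← lintegral_const_mul' _ _ ENNReal.ofReal_ne_top]
    refine (hx hT hX).trans (lintegral_mono_ae ((ae_velMeasure_mem wmin wmax).mono fun p hp => ?_))
    rw [enorm_mul, Real.enorm_eq_ofReal (hwmin.trans hp.1.le)]
    gcongr
    exact hp.2.le
  refine ne_top_of_le_ne_top ?_ h1
  simp_rw [lintegral_const_mul' _ _ (ENNReal.ofReal_ne_top (r := wmax))]
  refine ENNReal.mul_ne_top ENNReal.ofReal_ne_top ?_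
  have h2 := h.density.2.2
  unfold HasFiniteIntegral phaseMeasure at h2
  have hm := h.density.1.enorm
  rw [lintegral_prod _ hm.aemeasurable] at h2
  have h3 : ∀ t, ∫⁻ z, ‖u t z.1 z.2.1 z.2.2‖ₑ
      ∂((volume.restrict (Ioo (0 : ℝ) 1)).prod (velMeasure wmin wmax)) =
      ∫⁻ x in Ioo (0 : ℝ) 1, ∫⁻ p, ‖u t x p.1 p.2‖ₑ ∂velMeasure wmin wmax := fun t =>
    lintegral_prod _ (hm.comp (by fun_prop :
      Measurable fun z : ℝ × ℝ × ℝ => (t, z))).aemeasurable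
  simp only [h3] at h2
  exact h2.ne

theorem boundarySource_zero_left {wmin wmax : ℝ} {σ : ℝ → ℝ≥0∞} (hσ : Measurable σ) (t x : ℝ) :
    boundarySource wmin wmax 0 σ t x = ∫⁻ w, σ w ∂freqMeasure wmin wmax := by
  unfold boundarySource posVelMeasure
  simp only [zero_mul, ite_self, zero_add]
  rw [lintegral_prod (fun p : ℝ × ℝ => σ p.2) (hσ.comp measurable_snd).aemeasurable]
  simp

/-- Inflow of size `K / μ` is felt at `x` only if `x < μ ω t ≤ μ A`. Then `√x ≤ √μ √A`, so `1 / μ ≤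
√A / (√μ √x)`: half of the singularity is traded for `1 / √x`, and the remaining `1 / √μ` is
integrable. -/
theorem boundarySource_zero_right_le {wmin wmax T t x : ℝ} (hwmin : 0 ≤ wmin) (K : ℝ≥0∞)
    (ht : t ∈ Ioo 0 T) (hx : x ∈ Ioo (0 : ℝ) 1) :
    boundarySource wmin wmax K 0 t x ≤
      K * (ENNReal.ofReal (wmax - wmin) * (2 * ENNReal.ofReal √(wmax * T) +
        ENNReal.ofReal (wmax * T))) * ENNReal.ofReal (1 / √x) := by
  have hsx : 0 < √x := Real.sqrt_pos.2 hx.1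
  have hsx1 : √x ≤ 1 := Real.sqrt_le_one.2 hx.2.le
  set A := wmax * T with hA
  have hμ : ∫⁻ m in Ioo (0 : ℝ) 1, ENNReal.ofReal (1 / √m) = 2 := by
    rw [setLIntegral_congr Ioo_ae_eq_Ioc, setLIntegral_inv_sqrt zero_le_one]
    simp
  have hint : ∫⁻ p, ENNReal.ofReal (1 / √p.1) ∂posVelMeasure wmin wmax =
      2 * ENNReal.ofReal (wmax - wmin) := by
    unfold posVelMeasure
    rw [lintegral_prod _ (by fun_prop)]
    simp only [lintegral_const]
    rw [lintegral_mul_const _ (by fun_prop), hμ]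
    simp [freqMeasure]
  have hpt : ∀ᵐ p ∂posVelMeasure wmin wmax,
      ((if x < p.1 * p.2 * t then K * ENNReal.ofReal (1 / p.1) else 0) +
        (if 1 < p.1 * p.2 * t then K * ENNReal.ofReal (1 / p.1) else 0) +
        (0 : ℝ → ℝ≥0∞) p.2) ≤
      K * ENNReal.ofReal (1 / √x) * (ENNReal.ofReal √A * ENNReal.ofReal (1 / √p.1) +
        ENNReal.ofReal A) := by
    filter_upwards [ae_posVelMeasure_mem wmin wmax] with p hm
    have hw0 : 0 < p.2 := hwmin.trans_lt hm.2.1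
    have hp0 := hm.1.1
    have hsp : 0 < √p.1 := Real.sqrt_pos.2 hp0
    have hwt : p.2 * t ≤ A := by
      rw [hA]; exact mul_le_mul hm.2.2.le ht.2.le ht.1.le (hw0.le.trans hm.2.2.le)
    have hA0 : 0 ≤ A := (mul_pos hw0 ht.1).le.trans hwt
    have hpA : p.1 * p.2 * t ≤ p.1 * A := by rw [mul_assoc]; gcongr
    rw [Pi.zero_apply, add_zero, mul_add]
    refine add_le_add ?_ ?_
    · split_ifs with h
      · rw [mul_assoc K, ← ENNReal.ofReal_mul (by positivity), ← ENNReal.ofReal_mul (by positivity)]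
        gcongr
        have h1 : √x ≤ √p.1 * √A := by
          rw [← Real.sqrt_mul hp0.le]
          exact Real.sqrt_le_sqrt (h.le.trans hpA)
        have h2 : p.1 = √p.1 * √p.1 := (Real.mul_self_sqrt hp0.le).symm
        rw [div_mul_eq_mul_div, one_mul, mul_one_div, div_div, div_le_div_iff₀ hp0 (by positivity)]
        calc 1 * (√p.1 * √x) ≤ √p.1 * (√p.1 * √A) := by rw [one_mul]; gcongr
          _ = √A * (√p.1 * √p.1) := by ring
          _ = √A * p.1 := by rw [← h2]
      · exact zero_le
    · split_ifs with h
      · rw [mul_assoc K, ← ENNReal.ofReal_mul (by positivity)]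
        gcongr
        have h1 : 1 / p.1 ≤ A := by rw [div_le_iff₀ hp0]; linarith
        have h2 : 1 ≤ 1 / √x := by rw [le_div_iff₀ hsx]; linarith
        nlinarith
      · exact zero_le
  unfold boundarySource
  refine (lintegral_mono_ae hpt).trans (le_of_eq ?_)
  rw [lintegral_const_mul _ (by fun_prop), lintegral_add_left (by fun_prop),
    lintegral_const_mul _ (by fun_prop), hint, lintegral_const, posVelMeasure_univ]
  ring

theorem growthFactor_ne_top (wmax T : ℝ) : growthFactor wmax T ≠ ∞ :=
  ENNReal.mul_ne_top ENNReal.ofReal_ne_top (ENNReal.pow_ne_top ENNReal.ofReal_ne_top)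

theorem maxwellianBound_ne_top (wmin wmax : ℝ) : maxwellianBound wmin wmax ≠ ∞ :=
  ENNReal.ofReal_ne_top

theorem exists_scattering_rate (wmin wmax T : ℝ) : ∃ l : ℝ, 0 < l ∧
    growthFactor wmax T * maxwellianBound wmin wmax *
      (18 * (ENNReal.ofReal (wmax - wmin) * ENNReal.ofReal (1 / l))) ≤ 2⁻¹ := by
  obtain ⟨l, hl, h⟩ := exists_rate (c := growthFactor wmax T * maxwellianBound wmin wmax *
      (18 * ENNReal.ofReal (wmax - wmin))) (ENNReal.mul_ne_top (ENNReal.mul_ne_top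
        (growthFactor_ne_top _ _) (maxwellianBound_ne_top _ _))
        (ENNReal.mul_ne_top (by simp) ENNReal.ofReal_ne_top))
  exact ⟨l, hl, by rwa [← mul_assoc 18, ← mul_assoc]⟩

theorem measurable_uncurry_scatter {wmin wmax : ℝ} {f : ℝ → ℝ → ℝ≥0∞}
    (hf : Measurable (Function.uncurry f)) :
    Measurable (Function.uncurry (scatter wmin wmax f)) := by
  unfold scatter Function.uncurry
  exact Measurable.lintegral_prod_left' (measurable_scatter hf)

/-- The `L¹` norm of `scatter` only needs the constant `3`, so the rate chosen for the barrier with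
`18` serves here too. -/
theorem weightedMass_scatter_le {wmin wmax T l : ℝ} (hl : 0 < l)
    (hc : growthFactor wmax T * maxwellianBound wmin wmax *
      (18 * (ENNReal.ofReal (wmax - wmin) * ENNReal.ofReal (1 / l))) ≤ 2⁻¹)
    {f : ℝ → ℝ → ℝ≥0∞} (hf : Measurable (Function.uncurry f)) :
    weightedMass l (fun t x => growthFactor wmax T * maxwellianBound wmin wmax *
      scatter wmin wmax f t x) ≤ 2⁻¹ * weightedMass l f := by
  rw [weightedMass_const_mul (measurable_uncurry_scatter hf), weightedMass_scatter hl hf,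
    ← mul_assoc]
  gcongr
  refine le_trans ?_ hc
  gcongr
  norm_num

/-! ### Estimates of the source and of the outgoing trace. -/

/-- The `L¹` norm of the source is controlled by the error in the reflection. -/
theorem exists_lintegral_extendSource_le (wmin wmax T : ℝ) (hwmin : 0 ≤ wmin) :
    ∃ C : ℝ≥0∞, C ≠ ∞ ∧ ∀ (σ : ℝ → ℝ≥0∞) (ρ : ℝ → ℝ → ℝ) (u : ℝ → ℝ → ℝ → ℝ → ℝ),
      Measurable σ → IsTransportSubsolution wmin wmax T 0 σ ρ u →
      ∫⁻ t, ∫⁻ x, extendSource T ρ t x ≤ C * ∫⁻ w, σ w ∂freqMeasure wmin wmax := by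
  obtain ⟨l, hl, hc⟩ := exists_scattering_rate wmin wmax T
  refine ⟨ENNReal.ofReal (Real.exp (l * T)) * (2 * (growthFactor wmax T * ENNReal.ofReal T)),
    ENNReal.mul_ne_top ENNReal.ofReal_ne_top (ENNReal.mul_ne_top (by simp)
      (ENNReal.mul_ne_top (growthFactor_ne_top _ _) ENNReal.ofReal_ne_top)),
    fun σ ρ u hσ h => ?_⟩
  have hfm : Measurable (Function.uncurry (extendSource T ρ)) :=
    measurable_extendSource h.measurable_source
  set s := ∫⁻ w, σ w ∂freqMeasure wmin wmax with hs
  -- The boundary source is constant here; it is cut off to the box to have finite mass.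
  set b : ℝ → ℝ → ℝ≥0∞ := fun t x =>
    (Ioo 0 T ×ˢ Ioo (0 : ℝ) 1).indicator (fun _ => growthFactor wmax T * s) (t, x) with hb
  have hbm : Measurable (Function.uncurry b) :=
    measurable_const.indicator (measurableSet_Ioo.prod measurableSet_Ioo)
  have hbmass : weightedMass l b ≤ growthFactor wmax T * s * ENNReal.ofReal T := by
    refine (weightedMass_le_of_box hl.le (T := T) (G := fun _ _ => growthFactor wmax T * s)
      (ae_of_all _ fun t => ae_of_all _ fun x _ _ =>
        indicator_le_self _ (fun _ => growthFactor wmax T * s) (t, x))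
      fun t x h => indicator_of_notMem (show (t, x) ∉ Ioo 0 T ×ˢ Ioo (0 : ℝ) 1 from h) _).trans ?_
    simp
  have hle : weightedMass l (extendSource T ρ) ≤
      weightedMass l b + 2⁻¹ * weightedMass l (extendSource T ρ) := by
    refine le_trans ?_ (add_le_add_right (weightedMass_scatter_le hl hc hfm) _)
    rw [← weightedMass_add hbm]
    refine weightedMass_mono ?_
    filter_upwards [h.extendSource_le hwmin hσ] with t ht
    filter_upwards [ht] with x hx
    by_cases hm : t ∈ Ioo 0 T ∧ x ∈ Ioo (0 : ℝ) 1
    · refine (hx hm.1 hm.2).trans ?_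
      rw [boundarySource_zero_left hσ, hb]
      simp only
      rw [indicator_of_mem (show (t, x) ∈ Ioo 0 T ×ˢ Ioo (0 : ℝ) 1 from hm)]
    · rw [extendSource_of_notMem hm]
      exact zero_le
  have h1 := le_two_mul_of_le_add_mul (h.weightedMass_ne_top hwmin hl.le) le_rfl hle
  refine (lintegral_le_weightedMass hl.le fun t x => extendSource_of_notMem).trans ?_
  rw [mul_assoc]
  gcongr
  refine h1.trans ?_
  rw [mul_assoc]
  gcongr
  refine hbmass.trans (le_of_eq ?_)
  ring

/-- `L¹` stability of the outgoing trace with respect to the error in the reflection. -/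
theorem exists_lintegral_outflow_le (wmin wmax T : ℝ) (hwmin : 0 ≤ wmin) :
    ∃ C : ℝ≥0∞, C ≠ ∞ ∧ ∀ (σ : ℝ → ℝ≥0∞) (ρ : ℝ → ℝ → ℝ) (u : ℝ → ℝ → ℝ → ℝ → ℝ),
      Measurable σ → IsTransportSubsolution wmin wmax T 0 σ ρ u →
      ∀ᵐ p ∂posVelMeasure wmin wmax, ENNReal.ofReal (p.1 * p.2) *
        ∫⁻ t in Ioo 0 T, ‖u t 1 p.1 p.2‖ₑ ≤ C * ∫⁻ w, σ w ∂freqMeasure wmin wmax := by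
  obtain ⟨C, hC, h⟩ := exists_lintegral_extendSource_le wmin wmax T hwmin
  set D := ENNReal.ofReal (Real.exp (wmax * T)) * maxwellianBound wmin wmax with hD
  have hDt : D ≠ ∞ := ENNReal.mul_ne_top ENNReal.ofReal_ne_top (maxwellianBound_ne_top _ _)
  refine ⟨D * C, ENNReal.mul_ne_top hDt hC, fun σ ρ u hσ hu => ?_⟩
  have hfm : Measurable (Function.uncurry (extendSource T ρ)) :=
    measurable_extendSource hu.measurable_source
  filter_upwards [hu.enorm_outflow_le hwmin, ae_posVelMeasure_mem wmin wmax] with p hp hm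
  have hv : 0 < p.1 * p.2 := mul_pos hm.1.1 (hwmin.trans_lt hm.2.1)
  -- With zero inflow, the trace at `x = 1` is fed by the source alone.
  have h1 : ∫⁻ t in Ioo 0 T, ‖u t 1 p.1 p.2‖ₑ ≤
      D * ∫⁻ t, transit (p.1 * p.2) (extendSource T ρ) t 1 := by
    rw [← lintegral_const_mul' _ _ hDt]
    refine le_trans ?_ (setLIntegral_le_lintegral (Ioo 0 T) _)
    refine lintegral_mono_ae ((ae_restrict_iff' measurableSet_Ioo).2 (hp.mono fun t h1 ht => ?_))
    refine (h1 ht).trans (le_of_eq ?_)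
    simp only [zero_mul, ite_self, zero_add, hD, mul_assoc]
  calc _ ≤ ENNReal.ofReal (p.1 * p.2) *
        (D * ∫⁻ t, transit (p.1 * p.2) (extendSource T ρ) t 1) := by gcongr
    _ = D * (ENNReal.ofReal (p.1 * p.2) * ∫⁻ t, transit (p.1 * p.2) (extendSource T ρ) t 1) := by
        ring
    _ ≤ D * (C * ∫⁻ w, σ w ∂freqMeasure wmin wmax) := by
        refine mul_le_mul_right ?_ D
        exact (lintegral_transit_le hv 1 hfm).trans (h σ ρ u hσ hu)
    _ = _ := by ring

/-- The outgoing trace is bounded even if the inflow has the singularity `1 / μ`. -/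
theorem exists_enorm_outflow_le (wmin wmax T : ℝ) (hwmin : 0 ≤ wmin) :
    ∃ C : ℝ≥0∞, C ≠ ∞ ∧ ∀ (K : ℝ≥0∞) (ρ : ℝ → ℝ → ℝ) (u : ℝ → ℝ → ℝ → ℝ → ℝ),
      IsTransportSubsolution wmin wmax T K 0 ρ u →
      ∀ᵐ p ∂posVelMeasure wmin wmax, ∀ᵐ t, t ∈ Ioo 0 T → ‖u t 1 p.1 p.2‖ₑ ≤ C * K := by
  obtain ⟨l, hl, hc⟩ := exists_scattering_rate wmin wmax T
  set G := growthFactor wmax T with hG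
  set M := maxwellianBound wmin wmax with hM
  set E := ENNReal.ofReal (Real.exp (wmax * T)) with hE
  set S := ENNReal.ofReal (wmax - wmin) * (2 * ENNReal.ofReal √(wmax * T) +
        ENNReal.ofReal (wmax * T)) with hS
  set R := ENNReal.ofReal (6 / l) * ENNReal.ofReal (Real.exp (l * T)) with hR
  have hGt : G ≠ ∞ := growthFactor_ne_top _ _
  have hMt : M ≠ ∞ := maxwellianBound_ne_top _ _
  refine ⟨E * (ENNReal.ofReal (wmax * T) + M * (2 * G * S * R)), ?_, fun K ρ u h => ?_⟩
  · have hSt : S ≠ ∞ := by rw [hS]; finiteness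
    have hRt : R ≠ ∞ := by rw [hR]; finiteness
    finiteness
  set f := extendSource T ρ with hf
  have hfm : Measurable (Function.uncurry f) := measurable_extendSource h.measurable_source
  -- The factor `2` lets the boundary source use half of the barrier `b`; scattering of `b` uses the
  -- other half, by the choice of `l`.
  set B := 2 * G * S * K with hB
  set b : ℝ → ℝ → ℝ≥0∞ := fun t x => B * barrier l t x with hb
  have hbm : Measurable (Function.uncurry b) := (measurable_barrier l).const_mul B
  -- Truncated subtraction in `ℝ≥0∞`, so `d` is the positive part of the excess over the barrier;
  -- the aim is `d = 0` almost everywhere.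
  set d : ℝ → ℝ → ℝ≥0∞ := fun t x => f t x - b t x with hd
  have hdm : Measurable (Function.uncurry d) := hfm.sub hbm
  have hfbd : ∀ t x, f t x ≤ b t x + d t x := fun t x => le_add_tsub
  have hd0 : ∀ t x, ¬(t ∈ Ioo 0 T ∧ x ∈ Ioo (0 : ℝ) 1) → d t x = 0 := fun t x hm => by
    simp only [hd, hf, extendSource_of_notMem hm, zero_tsub]
  have hdle : ∀ᵐ t, ∀ᵐ x, d t x ≤ G * M * scatter wmin wmax d t x := by
    filter_upwards [h.extendSource_le hwmin measurable_zero] with t ht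
    filter_upwards [ht] with x hx
    by_cases hm : t ∈ Ioo 0 T ∧ x ∈ Ioo (0 : ℝ) 1
    swap
    · rw [hd0 t x hm]; exact zero_le
    simp only [hd]
    rw [tsub_le_iff_left]
    refine (hx hm.1 hm.2).trans ?_
    have h1 : G * boundarySource wmin wmax K 0 t x ≤ 2⁻¹ * b t x := by
      have h2 := boundarySource_zero_right_le (wmax := wmax) hwmin K hm.1 hm.2
      have h3 : ENNReal.ofReal (1 / √x) ≤ barrier l t x := by
        refine ENNReal.ofReal_le_ofReal (le_mul_of_one_le_left (by positivity) ?_)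
        exact Real.one_le_exp (mul_nonneg hl.le hm.1.1.le)
      calc G * boundarySource wmin wmax K 0 t x ≤ G * (K * S * barrier l t x) := by
            gcongr
            exact h2.trans (by gcongr)
        _ = 2⁻¹ * 2 * (G * (K * S * barrier l t x)) := by
            rw [ENNReal.inv_mul_cancel (by simp) (by simp), one_mul]
        _ = _ := by simp only [hb, hB]; ring
    have h4 : G * M * scatter wmin wmax f t x ≤
        2⁻¹ * b t x + G * M * scatter wmin wmax d t x := by
      calc _ ≤ G * M * (scatter wmin wmax b t x + scatter wmin wmax d t x) := by
            gcongr
            rw [← scatter_add hbm]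
            exact scatter_mono hfbd
        _ ≤ G * M * (18 * (ENNReal.ofReal (wmax - wmin) * ENNReal.ofReal (1 / l)) * b t x) +
            G * M * scatter wmin wmax d t x := by
            rw [mul_add]
            gcongr
            exact scatter_barrier_le hwmin hl t hm.2 B
        _ ≤ _ := by
            rw [← mul_assoc]
            gcongr
    calc _ ≤ 2⁻¹ * b t x + (2⁻¹ * b t x + G * M * scatter wmin wmax d t x) := add_le_add h1 h4
      _ = _ := by rw [← add_assoc, ← add_mul, ENNReal.inv_two_add_inv_two, one_mul]
  have hdmass : weightedMass l d = 0 := by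
    have hfin : weightedMass l d ≠ ∞ := ne_top_of_le_ne_top (h.weightedMass_ne_top hwmin hl.le)
      (weightedMass_mono (ae_of_all _ fun t => ae_of_all _ fun x => tsub_le_self))
    have h1 : weightedMass l d ≤ 0 + 2⁻¹ * weightedMass l d := by
      rw [zero_add]
      exact (weightedMass_mono hdle).trans (weightedMass_scatter_le hl hc hdm)
    simpa using le_two_mul_of_le_add_mul hfin le_rfl h1
  have hdint : ∫⁻ t, ∫⁻ x, d t x = 0 := by
    simpa [hdmass] using lintegral_le_weightedMass (l := l) hl.le hd0
  filter_upwards [h.enorm_outflow_le hwmin, ae_posVelMeasure_mem wmin wmax] with p hp hm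
  have hw0 : 0 < p.2 := hwmin.trans_lt hm.2.1
  have hv : 0 < p.1 * p.2 := mul_pos hm.1.1 hw0
  -- That `d` vanishes almost everywhere says nothing about a single characteristic; the trace
  -- inequality gives it for almost every arrival time.
  have hd1 : ∀ᵐ t, transit (p.1 * p.2) d t 1 = 0 := by
    have h1 := lintegral_transit_le hv 1 hdm
    rw [hdint, nonpos_iff_eq_zero, mul_eq_zero] at h1
    have h2 : ∫⁻ t, transit (p.1 * p.2) d t 1 = 0 := h1.resolve_left (by simpa using hv)
    exact (lintegral_eq_zero_iff (measurable_transit_comp hdm (by fun_prop) (by fun_prop)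
      (by fun_prop))).1 h2
  filter_upwards [hp, hd1] with t ht htd hT
  have h1 : transit (p.1 * p.2) f t 1 ≤ B * R := by
    refine (transit_mono hfbd).trans ?_
    rw [transit_add hbm, htd, add_zero, transit_const_mul (measurable_barrier l)]
    gcongr
    refine (transit_barrier_le hl hv t one_pos).trans ?_
    rw [hR, barrier, Real.sqrt_one, one_div_one, mul_one]
    have := hT.2.le
    gcongr
  -- Direct inflow reaches `x = 1` by time `t` only if `1 / μ < ω t`, so its singularity is not seen
  -- there.
  have h2 : (if 1 < p.1 * p.2 * t then K * ENNReal.ofReal (1 / p.1) else 0) ≤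
      K * ENNReal.ofReal (wmax * T) := by
    split_ifs with hlt
    · gcongr
      rw [div_le_iff₀ hm.1.1]
      have : p.2 * t ≤ wmax * T := mul_le_mul hm.2.2.le hT.2.le hT.1.le (hw0.le.trans hm.2.2.le)
      nlinarith [hm.1.1]
    · exact zero_le
  calc _ ≤ E * (K * ENNReal.ofReal (wmax * T) + M * (B * R)) := (ht hT).trans (by gcongr)
    _ = _ := by rw [hB]; ring

/-! ### Forward and adjoint solutions as transport subsolutions. -/

theorem ae_ae_swap_of_ae_prod {α β : Type*} [MeasurableSpace α] [MeasurableSpace β]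
    {μ : Measure α} {ν : Measure β} [SFinite μ] [SFinite ν] {P : α × β → Prop}
    (h : ∀ᵐ z ∂μ.prod ν, P z) : ∀ᵐ y ∂ν, ∀ᵐ x ∂μ, P (x, y) :=
  Measure.ae_ae_of_ae_prod
    ((Measure.measurePreserving_swap (μ := ν) (ν := μ)).quasiMeasurePreserving.ae h)

theorem measurePreserving_neg_Ioo (a b : ℝ) : MeasurePreserving (fun x : ℝ => -x)
    (volume.restrict (Ioo a b)) (volume.restrict (Ioo (-b) (-a))) := by
  simpa using (Measure.measurePreserving_neg (volume : Measure ℝ)).restrict_preimage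
    (s := Ioo (-b) (-a)) measurableSet_Ioo

theorem measurePreserving_sub_time (T : ℝ) :
    MeasurePreserving (fun t : ℝ => T - t) (timeMeasure T) (timeMeasure T) := by
  unfold timeMeasure
  simpa using (Measure.measurePreserving_sub_left (volume : Measure ℝ) T).restrict_preimage
    (s := Ioo 0 T) measurableSet_Ioo

theorem measurePreserving_neg_vel (wmin wmax : ℝ) :
    MeasurePreserving (fun p : ℝ × ℝ => (-p.1, p.2)) (velMeasure wmin wmax)
      (velMeasure wmin wmax) := by
  have h := measurePreserving_neg_Ioo (-1) 1
  rw [neg_neg] at h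
  exact h.prod (MeasurePreserving.id (freqMeasure wmin wmax))

theorem measurePreserving_neg_bdry (wmin wmax T : ℝ) :
    MeasurePreserving (fun p : ℝ × ℝ × ℝ => (p.1, -p.2.1, p.2.2)) (posBdryMeasure wmin wmax T)
      (negBdryMeasure wmin wmax T) := by
  have h := measurePreserving_neg_Ioo 0 1
  rw [neg_zero] at h
  exact (MeasurePreserving.id (timeMeasure T)).prod
    (h.prod (MeasurePreserving.id (freqMeasure wmin wmax)))

theorem measurePreserving_neg_bdry' (wmin wmax T : ℝ) :
    MeasurePreserving (fun p : ℝ × ℝ × ℝ => (p.1, -p.2.1, p.2.2)) (negBdryMeasure wmin wmax T)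
      (posBdryMeasure wmin wmax T) := by
  have h := measurePreserving_neg_Ioo (-1) 0
  rw [neg_neg, neg_zero] at h
  exact (MeasurePreserving.id (timeMeasure T)).prod
    (h.prod (MeasurePreserving.id (freqMeasure wmin wmax)))

theorem measurePreserving_sub_bdry (wmin wmax T : ℝ) :
    MeasurePreserving (fun p : ℝ × ℝ × ℝ => (T - p.1, p.2)) (posBdryMeasure wmin wmax T)
      (posBdryMeasure wmin wmax T) :=
  (measurePreserving_sub_time T).prod (MeasurePreserving.id _)

theorem measurePreserving_sub_bdry' (wmin wmax T : ℝ) :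
    MeasurePreserving (fun p : ℝ × ℝ × ℝ => (T - p.1, p.2)) (negBdryMeasure wmin wmax T)
      (negBdryMeasure wmin wmax T) :=
  (measurePreserving_sub_time T).prod (MeasurePreserving.id _)

/-- The density `⟨ω g⟩`. -/
def flux (wmin wmax : ℝ) (g : ℝ → ℝ → ℝ → ℝ → ℝ) (t x : ℝ) : ℝ :=
  bracket wmin wmax fun μ ω => ω * g t x μ ω

theorem IsDensity.measurable_flux {wmin wmax T : ℝ} {g : ℝ → ℝ → ℝ → ℝ → ℝ}
    (hg : IsDensity wmin wmax T g) : Measurable (Function.uncurry (flux wmin wmax g)) := by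
  have h1 : Measurable fun z : (ℝ × ℝ) × ℝ × ℝ => z.2.2 * g z.1.1 z.1.2 z.2.1 z.2.2 :=
    Measurable.mul (by fun_prop) (hg.1.comp (by fun_prop : Measurable
      fun z : (ℝ × ℝ) × ℝ × ℝ => (z.1.1, z.1.2, z.2.1, z.2.2)))
  exact (StronglyMeasurable.integral_prod_right' (ν := velMeasure wmin wmax)
    h1.stronglyMeasurable).measurable

theorem IsDensity.ae_integrable {wmin wmax T : ℝ} {g : ℝ → ℝ → ℝ → ℝ → ℝ}
    (hwmin : 0 ≤ wmin) (hg : IsDensity wmin wmax T g) :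
    ∀ᵐ t, ∀ᵐ x, t ∈ Ioo 0 T → x ∈ Ioo (0 : ℝ) 1 →
      Integrable (fun p : ℝ × ℝ => p.2 * g t x p.1 p.2) (velMeasure wmin wmax) := by
  have h1 := hg.2
  unfold phaseMeasure at h1
  have h2 := h1.prod_right_ae
  rw [timeMeasure, ae_restrict_iff' measurableSet_Ioo] at h2
  filter_upwards [h2] with t ht
  by_cases hT : t ∈ Ioo 0 T
  swap
  · exact ae_of_all _ fun x h => absurd h hT
  have h3 := (ht hT).prod_right_ae
  rw [ae_restrict_iff' measurableSet_Ioo] at h3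
  filter_upwards [h3] with x hx _ hX
  refine (hx hX).bdd_mul (c := wmax) measurable_snd.aestronglyMeasurable ?_
  filter_upwards [ae_velMeasure_mem wmin wmax] with p hp
  rw [Real.norm_eq_abs, abs_of_nonneg (hwmin.trans hp.1.le)]
  exact hp.2.le

theorem IsForwardSolution.lines {wmin wmax T : ℝ} {η : ℝ → ℝ} {φ : ℝ → ℝ → ℝ → ℝ}
    {g : ℝ → ℝ → ℝ → ℝ → ℝ} (h : IsForwardSolution wmin wmax T η φ g) :
    ∀ᵐ p ∂velMeasure wmin wmax, SolvesAlongLines T (p.1 * p.2) p.2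
      (fun t x => maxwellian wmin wmax p.2 * flux wmin wmax g t x) (fun t x => g t x p.1 p.2) :=
  Measure.ae_ae_of_ae_prod h.transport

theorem SolvesAlongLines.sub {T v k : ℝ} {q₁ q₂ u₁ u₂ : ℝ → ℝ → ℝ}
    (h₁ : SolvesAlongLines T v k q₁ u₁) (h₂ : SolvesAlongLines T v k q₂ u₂) :
    SolvesAlongLines T v k (fun t x => q₁ t x - q₂ t x) (fun t x => u₁ t x - u₂ t x) := by
  filter_upwards [h₁, h₂] with y hy₁ hy₂ s₁ s₂ h0 h12 hT hm1 hm2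
  obtain ⟨i1, e1⟩ := hy₁ s₁ s₂ h0 h12 hT hm1 hm2
  obtain ⟨i2, e2⟩ := hy₂ s₁ s₂ h0 h12 hT hm1 hm2
  have e : (fun s => -(k * (u₁ s (y + v * s) - u₂ s (y + v * s))) +
      (q₁ s (y + v * s) - q₂ s (y + v * s))) =
      fun s => (-(k * u₁ s (y + v * s)) + q₁ s (y + v * s)) -
        (-(k * u₂ s (y + v * s)) + q₂ s (y + v * s)) := by
    funext s; ring
  rw [e]
  refine ⟨i1.sub i2, ?_⟩
  rw [intervalIntegral.integral_sub i1 i2, ← e1, ← e2]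
  ring

theorem IsForwardSolution.ae_initial {wmin wmax T : ℝ} {η : ℝ → ℝ} {φ : ℝ → ℝ → ℝ → ℝ}
    {g : ℝ → ℝ → ℝ → ℝ → ℝ} (h : IsForwardSolution wmin wmax T η φ g) :
    ∀ᵐ p ∂velMeasure wmin wmax, ∀ᵐ x, x ∈ Ioo (0 : ℝ) 1 → g 0 x p.1 p.2 = 0 := by
  filter_upwards [ae_ae_swap_of_ae_prod h.initial] with p hp
  exact (ae_restrict_iff' measurableSet_Ioo).1 hp

theorem ae_posBdryMeasure {wmin wmax T : ℝ} {P : ℝ × ℝ × ℝ → Prop}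
    (h : ∀ᵐ z ∂posBdryMeasure wmin wmax T, P z) :
    ∀ᵐ p ∂posVelMeasure wmin wmax, ∀ᵐ t, t ∈ Ioo 0 T → P (t, p) := by
  filter_upwards [ae_ae_swap_of_ae_prod (μ := timeMeasure T) (ν := posVelMeasure wmin wmax) h]
    with p hp
  exact (ae_restrict_iff' measurableSet_Ioo).1 hp

theorem ae_posVelMeasure_of_ae_freqMeasure {wmin wmax : ℝ} {P : ℝ → Prop}
    (h : ∀ᵐ w ∂freqMeasure wmin wmax, P w) : ∀ᵐ p ∂posVelMeasure wmin wmax, P p.2 :=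
  Measure.quasiMeasurePreserving_snd.ae h

theorem IsForwardSolution.sub {wmin wmax T : ℝ} (hwmin : 0 ≤ wmin) {η₁ η₂ : ℝ → ℝ}
    {φ₁ φ₂ : ℝ → ℝ → ℝ → ℝ} {g₁ g₂ : ℝ → ℝ → ℝ → ℝ → ℝ} {K : ℝ≥0∞} {σ : ℝ → ℝ≥0∞}
    (hη : IsReflection wmin wmax η₁)
    (h₁ : IsForwardSolution wmin wmax T η₁ φ₁ g₁) (h₂ : IsForwardSolution wmin wmax T η₂ φ₂ g₂)
    (hφ : ∀ᵐ p ∂posBdryMeasure wmin wmax T,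
      ‖φ₁ p.1 p.2.1 p.2.2 - φ₂ p.1 p.2.1 p.2.2‖ₑ ≤ K * ENNReal.ofReal (1 / p.2.1))
    (hσ : ∀ᵐ p ∂posVelMeasure wmin wmax, ∀ᵐ t, t ∈ Ioo 0 T →
      ‖(η₁ p.2 - η₂ p.2) * g₂ t 1 p.1 p.2‖ₑ ≤ σ p.2) :
    IsTransportSubsolution wmin wmax T K σ
      (fun t x => flux wmin wmax g₁ t x - flux wmin wmax g₂ t x)
      (fun t x μ ω => g₁ t x μ ω - g₂ t x μ ω) where
  density := ⟨h₁.density.1.sub h₂.density.1, h₁.density.2.sub h₂.density.2⟩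
  measurable_source := h₁.density.measurable_flux.sub h₂.density.measurable_flux
  source_le := by
    filter_upwards [h₁.density.ae_integrable hwmin, h₂.density.ae_integrable hwmin] with t ht1 ht2
    filter_upwards [ht1, ht2] with x hx1 hx2 hT hX
    unfold flux bracket
    rw [← integral_sub (hx1 hT hX) (hx2 hT hX)]
    refine (enorm_integral_le_lintegral_enorm _).trans (le_of_eq ?_)
    simp_rw [mul_sub]
  lines := by
    filter_upwards [h₁.lines, h₂.lines] with p hp1 hp2
    have := hp1.sub hp2
    simpa only [← mul_sub] using this
  initial := by
    filter_upwards [h₁.ae_initial, h₂.ae_initial] with p hp1 hp2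
    filter_upwards [hp1, hp2] with x hx1 hx2 hX
    rw [hx1 hX, hx2 hX, sub_zero]
  inflow := by
    filter_upwards [ae_posBdryMeasure h₁.incoming, ae_posBdryMeasure h₂.incoming,
      ae_posBdryMeasure hφ] with p hp1 hp2 hp3
    filter_upwards [hp1, hp2, hp3] with t ht1 ht2 ht3 hT
    rw [ht1 hT, ht2 hT]
    exact ht3 hT
  reflection := by
    have r1 := (measurePreserving_neg_bdry wmin wmax T).quasiMeasurePreserving.ae h₁.reflection
    have r2 := (measurePreserving_neg_bdry wmin wmax T).quasiMeasurePreserving.ae h₂.reflection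
    filter_upwards [ae_posBdryMeasure r1, ae_posBdryMeasure r2, hσ,
      ae_posVelMeasure_of_ae_freqMeasure hη.2] with p hp1 hp2 hp3 hη
    filter_upwards [hp1, hp2, hp3] with t ht1 ht2 ht3 hT
    have e1 := ht1 hT
    have e2 := ht2 hT
    simp only [neg_neg] at e1 e2
    -- The reflected difference splits into a contraction of the outgoing difference, as `0 ≤ η₁ ≤
    -- 1`, and the error made by changing the coefficient.
    rw [e1, e2, show η₁ p.2 * g₁ t 1 p.1 p.2 - η₂ p.2 * g₂ t 1 p.1 p.2 =
      η₁ p.2 * (g₁ t 1 p.1 p.2 - g₂ t 1 p.1 p.2) + (η₁ p.2 - η₂ p.2) * g₂ t 1 p.1 p.2 by ring]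
    refine (enorm_add_le _ _).trans (add_le_add ?_ (ht3 hT))
    rw [enorm_mul]
    refine mul_le_of_le_one_left' ?_
    rw [Real.enorm_eq_ofReal hη.1, ENNReal.ofReal_le_one]
    exact hη.2

/-- Comparison with the zero solution turns estimates for differences into estimates for a single
solution. -/
theorem isForwardSolution_zero (wmin wmax T : ℝ) (η : ℝ → ℝ) :
    IsForwardSolution wmin wmax T η (fun _ _ _ => 0) (fun _ _ _ _ => 0) where
  density := ⟨measurable_const, integrable_zero _ _ _⟩
  transport := by
    refine ae_of_all _ fun q s₁ s₂ _ _ _ _ _ => ?_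
    simp [collision, bracket]
  initial := ae_of_all _ fun _ => rfl
  incoming := ae_of_all _ fun _ => rfl
  reflection := ae_of_all _ fun _ => by simp

theorem bracket_neg (wmin wmax : ℝ) (f : ℝ → ℝ → ℝ) :
    bracket wmin wmax (fun μ ω => f (-μ) ω) = bracket wmin wmax f := by
  unfold bracket
  have hemb : MeasurableEmbedding (fun p : ℝ × ℝ => (-p.1, p.2)) :=
    ((MeasurableEquiv.neg ℝ).prodCongr (MeasurableEquiv.refl ℝ)).measurableEmbedding
  exact (measurePreserving_neg_vel wmin wmax).integral_comp hemb fun p => f p.1 p.2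

/-- Reversing time and velocity turns adjoint solutions into forward solutions. -/
theorem IsAdjointSolution.reverse {wmin wmax T : ℝ} {η ψ : ℝ → ℝ} {h : ℝ → ℝ → ℝ → ℝ → ℝ}
    (hh : IsAdjointSolution wmin wmax T η ψ h) :
    IsForwardSolution wmin wmax T η (fun t μ ω => ψ (T - t) * gStar ω / -μ)
      (fun t x μ ω => h (T - t) x (-μ) ω) where
  density := by
    refine ⟨hh.density.1.comp (by fun_prop : Measurable fun p : ℝ × ℝ × ℝ × ℝ =>
      (T - p.1, p.2.1, -p.2.2.1, p.2.2.2)), ?_⟩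
    have hmp : MeasurePreserving (fun p : ℝ × ℝ × ℝ × ℝ => (T - p.1, p.2.1, -p.2.2.1, p.2.2.2))
        (phaseMeasure wmin wmax T) (phaseMeasure wmin wmax T) :=
      (measurePreserving_sub_time T).prod ((MeasurePreserving.id _).prod
        (measurePreserving_neg_vel wmin wmax))
    exact hmp.integrable_comp_of_integrable hh.density.2
  transport := by
    have hcol : ∀ t x μ ω, collision wmin wmax (fun t x μ ω => h (T - t) x (-μ) ω) t x μ ω =
        collision wmin wmax h (T - t) x (-μ) ω := by
      intro t x μ ω
      unfold collision
      rw [bracket_neg wmin wmax fun μ' ω' => ω' * h (T - t) x μ' ω']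
    -- The reversed line `s ↦ (T - s, y + μ ω s)` is a characteristic of velocity `-μ` with offset
    -- `y + μ ω T`. This shear of the line parameters preserves null sets.
    have hqm : Measure.QuasiMeasurePreserving
        (fun q : (ℝ × ℝ) × ℝ => ((-q.1.1, q.1.2), q.2 + q.1.1 * q.1.2 * T))
        ((velMeasure wmin wmax).prod volume) ((velMeasure wmin wmax).prod volume) :=
      ((measurePreserving_neg_vel wmin wmax).skew_product (g := fun (p : ℝ × ℝ) (y : ℝ) =>
        y + p.1 * p.2 * T) (by fun_prop) (ae_of_all _ fun p =>
          (measurePreserving_add_right volume (p.1 * p.2 * T)).map_eq)).quasiMeasurePreserving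
    filter_upwards [hqm.ae hh.transport] with q hq s₁ s₂ h0 h12 hT hm1 hm2
    have e : ∀ s, q.2 + q.1.1 * q.1.2 * T + -q.1.1 * q.1.2 * s =
        q.2 + q.1.1 * q.1.2 * (T - s) := fun s => by ring
    simp only [e] at hq
    obtain ⟨i1, e1⟩ := hq (T - s₂) (T - s₁) (by linarith) (by linarith) (by linarith)
      (by rwa [sub_sub_cancel]) (by rwa [sub_sub_cancel])
    simp only [sub_sub_cancel] at e1
    simp only [hcol]
    have i2 := (i1.comp_sub_left T).neg.symm
    simp only [sub_sub_cancel, Pi.neg_def, neg_neg] at i2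
    refine ⟨i2, ?_⟩
    have e3 := intervalIntegral.integral_comp_sub_left (a := s₁) (b := s₂)
      (fun s => -collision wmin wmax h s (q.2 + q.1.1 * q.1.2 * (T - s)) (-q.1.1) q.1.2) T
    simp only [sub_sub_cancel] at e3
    rw [intervalIntegral.integral_neg] at e3
    rw [← e3] at e1
    linarith
  initial := by
    have := ((MeasurePreserving.id (volume.restrict (Ioo (0 : ℝ) 1))).prod
      (measurePreserving_neg_vel wmin wmax)).quasiMeasurePreserving.ae hh.final
    filter_upwards [this] with p hp
    simpa using hp
  incoming := by
    have := ((measurePreserving_neg_bdry wmin wmax T).comp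
      (measurePreserving_sub_bdry wmin wmax T)).quasiMeasurePreserving.ae hh.incoming
    filter_upwards [this] with p hp
    simpa using hp
  reflection := by
    have := ((measurePreserving_neg_bdry' wmin wmax T).comp
      (measurePreserving_sub_bdry' wmin wmax T)).quasiMeasurePreserving.ae hh.reflection
    filter_upwards [this] with p hp
    simpa using hp

/-! ### Bounds and stability of the traces at `x = 1`. -/

theorem exists_forward_estimates (wmin wmax T : ℝ) (hwmin : 0 ≤ wmin) :
    ∃ C : ℝ≥0∞, C ≠ ∞ ∧ ∀ (η₁ η₂ : ℝ → ℝ) (φ : ℝ → ℝ → ℝ → ℝ) (g₁ g₂ : ℝ → ℝ → ℝ → ℝ → ℝ)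
      (K : ℝ≥0∞), IsReflection wmin wmax η₁ → IsReflection wmin wmax η₂ →
      IsForwardSolution wmin wmax T η₁ φ g₁ → IsForwardSolution wmin wmax T η₂ φ g₂ →
      (∀ᵐ p ∂posBdryMeasure wmin wmax T,
        ‖φ p.1 p.2.1 p.2.2‖ₑ ≤ K * ENNReal.ofReal (1 / p.2.1)) →
      (∀ᵐ p ∂posVelMeasure wmin wmax, ∀ᵐ t, t ∈ Ioo 0 T → ‖g₂ t 1 p.1 p.2‖ₑ ≤ C * K) ∧
      ∀ᵐ p ∂posVelMeasure wmin wmax, ENNReal.ofReal (p.1 * p.2) *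
        ∫⁻ t in Ioo 0 T, ‖g₁ t 1 p.1 p.2 - g₂ t 1 p.1 p.2‖ₑ ≤
          C * K * ∫⁻ w, ‖η₁ w - η₂ w‖ₑ ∂freqMeasure wmin wmax := by
  obtain ⟨C₁, hC₁, H₁⟩ := exists_enorm_outflow_le wmin wmax T hwmin
  obtain ⟨C₂, hC₂, H₂⟩ := exists_lintegral_outflow_le wmin wmax T hwmin
  refine ⟨C₁ + C₂ * C₁, by finiteness, fun η₁ η₂ φ g₁ g₂ K hη₁ hη₂ hg₁ hg₂ hφ => ?_⟩
  have hb : ∀ᵐ p ∂posVelMeasure wmin wmax, ∀ᵐ t, t ∈ Ioo 0 T → ‖g₂ t 1 p.1 p.2‖ₑ ≤ C₁ * K := by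
    have := hg₂.sub (K := K) (σ := 0) hwmin hη₂ (isForwardSolution_zero wmin wmax T η₂)
      (by simpa using hφ) (by simp)
    simpa using H₁ K _ _ this
  refine ⟨?_, ?_⟩
  · filter_upwards [hb] with p hp
    filter_upwards [hp] with t ht hT
    refine (ht hT).trans ?_
    gcongr
    exact le_self_add
  have hm : AEMeasurable (fun w => η₁ w - η₂ w) (freqMeasure wmin wmax) := hη₁.1.sub hη₂.1
  -- The reflection error is at most `|η₁ - η₂|` times the bound on `g₂`. A measurable
  -- representative is used because the coefficients are only almost everywhere measurable.
  set σ : ℝ → ℝ≥0∞ := fun w => (C₁ * K) * ‖hm.mk _ w‖ₑ with hσ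
  have hσm : Measurable σ := (hm.measurable_mk.enorm).const_mul _
  have hsub := hg₁.sub (K := 0) (σ := σ) hwmin hη₁ hg₂ (by simp) (by
    filter_upwards [hb, ae_posVelMeasure_of_ae_freqMeasure hm.ae_eq_mk] with p hp he
    filter_upwards [hp] with t ht hT
    rw [enorm_mul, he, mul_comm, hσ]
    exact mul_le_mul' (ht hT) le_rfl)
  filter_upwards [H₂ σ _ _ hσm hsub] with p hp
  refine hp.trans ?_
  have e : ∫⁻ w, σ w ∂freqMeasure wmin wmax =
      (C₁ * K) * ∫⁻ w, ‖η₁ w - η₂ w‖ₑ ∂freqMeasure wmin wmax := by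
    rw [hσ, lintegral_const_mul _ hm.measurable_mk.enorm]
    congr 1
    refine lintegral_congr_ae ?_
    filter_upwards [hm.ae_eq_mk] with w hw
    rw [hw]
  rw [e]
  calc _ = C₂ * C₁ * K * ∫⁻ w, ‖η₁ w - η₂ w‖ₑ ∂freqMeasure wmin wmax := by ring
    _ ≤ _ := by gcongr; exact le_add_self

theorem ae_enorm_inflow_le (wmin wmax T : ℝ) (φ : ℝ → ℝ → ℝ → ℝ) :
    ∀ᵐ p ∂posBdryMeasure wmin wmax T, ‖φ p.1 p.2.1 p.2.2‖ₑ ≤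
      eLpNorm (fun p : ℝ × ℝ × ℝ => φ p.1 p.2.1 p.2.2) ∞ (posBdryMeasure wmin wmax T) *
        ENNReal.ofReal (1 / p.2.1) := by
  have hmem : ∀ᵐ p ∂posBdryMeasure wmin wmax T, p.2.1 ∈ Ioo (0 : ℝ) 1 :=
    Measure.quasiMeasurePreserving_snd.ae (p := fun q : ℝ × ℝ => q.1 ∈ Ioo (0 : ℝ) 1)
      ((ae_posVelMeasure_mem wmin wmax).mono fun _ h => h.1)
  filter_upwards [enorm_ae_le_eLpNormEssSup (fun p : ℝ × ℝ × ℝ => φ p.1 p.2.1 p.2.2)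
    (posBdryMeasure wmin wmax T), hmem] with p hp hm
  rw [eLpNorm_exponent_top]
  refine hp.trans (le_mul_of_one_le_right' ?_)
  rw [ENNReal.one_le_ofReal, le_div_iff₀ hm.1]
  linarith [hm.2]

theorem ae_enorm_adjoint_inflow_le {wmin wmax : ℝ} (hwmin : 0 ≤ wmin) (T : ℝ) (ψ : ℝ → ℝ) :
    ∀ᵐ p ∂posBdryMeasure wmin wmax T, ‖ψ (T - p.1) * gStar p.2.2 / -p.2.1‖ₑ ≤
      eLpNorm ψ ∞ (timeMeasure T) * ENNReal.ofReal (Real.exp wmax) *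
        ENNReal.ofReal (1 / p.2.1) := by
  have hmem : ∀ᵐ p ∂posBdryMeasure wmin wmax T, p.2.1 ∈ Ioo (0 : ℝ) 1 ∧ p.2.2 ∈ Ioo wmin wmax :=
    Measure.quasiMeasurePreserving_snd.ae
      (p := fun q : ℝ × ℝ => q.1 ∈ Ioo (0 : ℝ) 1 ∧ q.2 ∈ Ioo wmin wmax)
      (ae_posVelMeasure_mem wmin wmax)
  have hψ : ∀ᵐ p ∂posBdryMeasure wmin wmax T, ‖ψ (T - p.1)‖ₑ ≤ eLpNormEssSup ψ (timeMeasure T) :=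
    Measure.quasiMeasurePreserving_fst.ae ((measurePreserving_sub_time T).quasiMeasurePreserving.ae
      (enorm_ae_le_eLpNormEssSup ψ (timeMeasure T)))
  filter_upwards [hψ, hmem] with p hp hm
  have hw0 : 0 < p.2.2 := hwmin.trans_lt hm.2.1
  rw [eLpNorm_exponent_top, div_eq_mul_inv, enorm_mul, enorm_mul]
  gcongr
  · rw [Real.enorm_eq_ofReal ((Real.exp_nonneg _).trans (le_gStar hw0 hm.2.2.le))]
    exact ENNReal.ofReal_le_ofReal (gStar_le hw0 hm.2.2.le)
  · rw [Real.enorm_eq_ofReal_abs, inv_neg, abs_neg, abs_of_pos (inv_pos.2 hm.1.1), one_div]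

theorem exists_adjoint_estimates (wmin wmax T : ℝ) (hwmin : 0 ≤ wmin) :
    ∃ C : ℝ≥0∞, C ≠ ∞ ∧ ∀ (η₁ η₂ : ℝ → ℝ) (ψ : ℝ → ℝ) (h₁ h₂ : ℝ → ℝ → ℝ → ℝ → ℝ),
      IsReflection wmin wmax η₁ → IsReflection wmin wmax η₂ →
      IsAdjointSolution wmin wmax T η₁ ψ h₁ → IsAdjointSolution wmin wmax T η₂ ψ h₂ →
      (∀ᵐ p ∂posVelMeasure wmin wmax, ∀ᵐ t, t ∈ Ioo 0 T →
        ‖h₂ t 1 (-p.1) p.2‖ₑ ≤ C * eLpNorm ψ ∞ (timeMeasure T)) ∧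
      ∀ᵐ p ∂posVelMeasure wmin wmax, ENNReal.ofReal (p.1 * p.2) *
        ∫⁻ t in Ioo 0 T, ‖h₁ t 1 (-p.1) p.2 - h₂ t 1 (-p.1) p.2‖ₑ ≤
          C * eLpNorm ψ ∞ (timeMeasure T) *
            ∫⁻ w, ‖η₁ w - η₂ w‖ₑ ∂freqMeasure wmin wmax := by
  obtain ⟨C, hC, H⟩ := exists_forward_estimates wmin wmax T hwmin
  refine ⟨C * ENNReal.ofReal (Real.exp wmax), by finiteness,
    fun η₁ η₂ ψ h₁ h₂ hη₁ hη₂ hh₁ hh₂ => ?_⟩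
  obtain ⟨H1, H2⟩ := H η₁ η₂ _ _ _ _ hη₁ hη₂ hh₁.reverse hh₂.reverse
    (ae_enorm_adjoint_inflow_le hwmin T ψ)
  have eC : C * ENNReal.ofReal (Real.exp wmax) * eLpNorm ψ ∞ (timeMeasure T) =
      C * (eLpNorm ψ ∞ (timeMeasure T) * ENNReal.ofReal (Real.exp wmax)) := by ring
  rw [eC]
  refine ⟨?_, ?_⟩
  · filter_upwards [H1] with p hp
    filter_upwards [ae_comp_affine (a := -1) (by norm_num) T hp] with t ht hT
    have e : T - (-1 * t + T) = t := by ring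
    rw [e] at ht
    exact ht ⟨by linarith [hT.2], by linarith [hT.1]⟩
  · filter_upwards [H2] with p hp
    have hm : Measurable fun t => ‖h₁ t 1 (-p.1) p.2 - h₂ t 1 (-p.1) p.2‖ₑ :=
      ((hh₁.density.1.comp (by fun_prop : Measurable fun t : ℝ =>
        (t, (1 : ℝ), -p.1, p.2))).sub (hh₂.density.1.comp (by fun_prop : Measurable fun t : ℝ =>
        (t, (1 : ℝ), -p.1, p.2)))).enorm
    have e := (measurePreserving_sub_time T).lintegral_comp hm
    unfold timeMeasure at e
    rwa [e] at hp

/-! ### Estimates of the gradient. -/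

theorem measurable_gStar : Measurable gStar := by
  unfold gStar
  fun_prop

theorem measurable_gradIntegrand {wmin wmax T : ℝ} {g h : ℝ → ℝ → ℝ → ℝ → ℝ}
    (hg : IsDensity wmin wmax T g) (hh : IsDensity wmin wmax T h) :
    Measurable fun z : ℝ × ℝ × ℝ => gradIntegrand g h z.1 z.2 := by
  unfold gradIntegrand
  refine Measurable.div (Measurable.mul (Measurable.mul (by fun_prop) ?_) ?_)
    (measurable_gStar.comp measurable_fst)
  · exact hh.1.comp (by fun_prop : Measurable fun z : ℝ × ℝ × ℝ => (z.2.2, (1 : ℝ), z.2.1, z.1))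
  · exact hg.1.comp (by fun_prop : Measurable fun z : ℝ × ℝ × ℝ => (z.2.2, (1 : ℝ), -z.2.1, z.1))

theorem enorm_gradIntegrand_sub_le {wmax ω m t : ℝ} {g₁ g₂ h₁ h₂ : ℝ → ℝ → ℝ → ℝ → ℝ}
    {A B : ℝ≥0∞} (hω : 0 < ω) (hω' : ω ≤ wmax) (hm : 0 < m)
    (hh : ‖h₁ t 1 (-m) ω‖ₑ ≤ B) (hg : ‖g₂ t 1 m ω‖ₑ ≤ A) :
    ‖gradIntegrand g₁ h₁ ω (-m, t) - gradIntegrand g₂ h₂ ω (-m, t)‖ₑ ≤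
      ENNReal.ofReal (Real.exp wmax) * (B * (ENNReal.ofReal (m * ω) *
        ‖g₁ t 1 m ω - g₂ t 1 m ω‖ₑ) + A * (ENNReal.ofReal (m * ω) *
        ‖h₁ t 1 (-m) ω - h₂ t 1 (-m) ω‖ₑ)) := by
  have hgs := le_gStar hω hω'
  have hgs0 : 0 < gStar ω := (Real.exp_pos _).trans_le hgs
  -- The product rule for differences, pairing a bounded trace with an `L¹`-small one; the factor `m
  -- ω` is the weight required by the trace stability.
  have e : gradIntegrand g₁ h₁ ω (-m, t) - gradIntegrand g₂ h₂ ω (-m, t) =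
      -((gStar ω)⁻¹ * (m * ω)) * (h₁ t 1 (-m) ω * (g₁ t 1 m ω - g₂ t 1 m ω) +
        g₂ t 1 m ω * (h₁ t 1 (-m) ω - h₂ t 1 (-m) ω)) := by
    simp only [gradIntegrand, neg_neg]
    ring
  have h1 : ‖(gStar ω)⁻¹‖ₑ ≤ ENNReal.ofReal (Real.exp wmax) := by
    rw [Real.enorm_eq_ofReal (inv_nonneg.2 hgs0.le)]
    refine ENNReal.ofReal_le_ofReal ?_
    rw [← neg_neg wmax, Real.exp_neg]
    gcongr
  rw [e, enorm_mul, enorm_neg, enorm_mul, Real.enorm_eq_ofReal (mul_pos hm hω).le]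
  calc _ ≤ ENNReal.ofReal (Real.exp wmax) * ENNReal.ofReal (m * ω) *
        (B * ‖g₁ t 1 m ω - g₂ t 1 m ω‖ₑ + A * ‖h₁ t 1 (-m) ω - h₂ t 1 (-m) ω‖ₑ) := by
        gcongr
        refine (enorm_add_le _ _).trans ?_
        rw [enorm_mul, enorm_mul]
        gcongr
    _ = _ := by ring

theorem lintegral_gradIntegrand_sub_le {wmin wmax T ω : ℝ} {g₁ g₂ h₁ h₂ : ℝ → ℝ → ℝ → ℝ → ℝ}
    {A B A' B' : ℝ≥0∞} (hω : 0 < ω) (hω' : ω ≤ wmax)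
    (hg₁ : IsDensity wmin wmax T g₁) (hg₂ : IsDensity wmin wmax T g₂)
    (hh₁ : IsDensity wmin wmax T h₁) (hh₂ : IsDensity wmin wmax T h₂)
    (hh : ∀ᵐ m ∂(volume.restrict (Ioo (0 : ℝ) 1)), ∀ᵐ t, t ∈ Ioo 0 T → ‖h₁ t 1 (-m) ω‖ₑ ≤ B)
    (hg : ∀ᵐ m ∂(volume.restrict (Ioo (0 : ℝ) 1)), ∀ᵐ t, t ∈ Ioo 0 T → ‖g₂ t 1 m ω‖ₑ ≤ A)
    (hg' : ∀ᵐ m ∂(volume.restrict (Ioo (0 : ℝ) 1)), ENNReal.ofReal (m * ω) *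
      ∫⁻ t in Ioo 0 T, ‖g₁ t 1 m ω - g₂ t 1 m ω‖ₑ ≤ A')
    (hh' : ∀ᵐ m ∂(volume.restrict (Ioo (0 : ℝ) 1)), ENNReal.ofReal (m * ω) *
      ∫⁻ t in Ioo 0 T, ‖h₁ t 1 (-m) ω - h₂ t 1 (-m) ω‖ₑ ≤ B') :
    ∫⁻ p, ‖gradIntegrand g₁ h₁ ω p - gradIntegrand g₂ h₂ ω p‖ₑ ∂gradMeasure T ≤
      ENNReal.ofReal (Real.exp wmax) * (B * A' + A * B') := by
  have hmp : MeasurePreserving (fun p : ℝ × ℝ => (-p.1, p.2))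
      ((volume.restrict (Ioo (0 : ℝ) 1)).prod (timeMeasure T)) (gradMeasure T) := by
    have h := measurePreserving_neg_Ioo 0 1
    rw [neg_zero] at h
    exact h.prod (MeasurePreserving.id _)
  have hmeas : Measurable fun p => ‖gradIntegrand g₁ h₁ ω p - gradIntegrand g₂ h₂ ω p‖ₑ :=
    (((measurable_gradIntegrand hg₁ hh₁).comp measurable_prodMk_left).sub
      ((measurable_gradIntegrand hg₂ hh₂).comp measurable_prodMk_left)).enorm
  rw [← hmp.lintegral_comp hmeas]
  refine (lintegral_prod_le _).trans ?_
  have hinner : ∀ᵐ m ∂(volume.restrict (Ioo (0 : ℝ) 1)),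
      ∫⁻ t, ‖gradIntegrand g₁ h₁ ω (-m, t) - gradIntegrand g₂ h₂ ω (-m, t)‖ₑ ∂timeMeasure T ≤
      ENNReal.ofReal (Real.exp wmax) * (B * A' + A * B') := by
    filter_upwards [hh, hg, hg', hh', ae_restrict_mem measurableSet_Ioo] with m m1 m2 m3 m4 m5
    have mg : Measurable fun t => ‖g₁ t 1 m ω - g₂ t 1 m ω‖ₑ :=
      ((hg₁.1.comp (by fun_prop : Measurable fun t : ℝ => (t, (1 : ℝ), m, ω))).sub
        (hg₂.1.comp (by fun_prop : Measurable fun t : ℝ => (t, (1 : ℝ), m, ω)))).enorm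
    have mh : Measurable fun t => ‖h₁ t 1 (-m) ω - h₂ t 1 (-m) ω‖ₑ :=
      ((hh₁.1.comp (by fun_prop : Measurable fun t : ℝ => (t, (1 : ℝ), -m, ω))).sub
        (hh₂.1.comp (by fun_prop : Measurable fun t : ℝ => (t, (1 : ℝ), -m, ω)))).enorm
    calc ∫⁻ t, ‖gradIntegrand g₁ h₁ ω (-m, t) - gradIntegrand g₂ h₂ ω (-m, t)‖ₑ ∂timeMeasure T
        ≤ ∫⁻ t in Ioo 0 T, ENNReal.ofReal (Real.exp wmax) * (B * (ENNReal.ofReal (m * ω) *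
          ‖g₁ t 1 m ω - g₂ t 1 m ω‖ₑ) + A * (ENNReal.ofReal (m * ω) *
          ‖h₁ t 1 (-m) ω - h₂ t 1 (-m) ω‖ₑ)) := by
          refine lintegral_mono_ae ((ae_restrict_iff' measurableSet_Ioo).2 ?_)
          filter_upwards [m1, m2] with t t1 t2 hT
          exact enorm_gradIntegrand_sub_le hω hω' m5.1 (t1 hT) (t2 hT)
      _ = ENNReal.ofReal (Real.exp wmax) * (B * (ENNReal.ofReal (m * ω) *
          ∫⁻ t in Ioo 0 T, ‖g₁ t 1 m ω - g₂ t 1 m ω‖ₑ) + A * (ENNReal.ofReal (m * ω) *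
          ∫⁻ t in Ioo 0 T, ‖h₁ t 1 (-m) ω - h₂ t 1 (-m) ω‖ₑ)) := by
          refine (lintegral_const_mul _ (((mg.const_mul _).const_mul _).add
            ((mh.const_mul _).const_mul _))).trans (congrArg _ ?_)
          refine (lintegral_add_left ((mg.const_mul _).const_mul _) _).trans ?_
          rw [lintegral_const_mul _ (mg.const_mul _), lintegral_const_mul _ mg,
            lintegral_const_mul _ (mh.const_mul _), lintegral_const_mul _ mh]
      _ ≤ _ := by gcongr
  refine (lintegral_mono_ae hinner).trans (le_of_eq ?_)
  simp

theorem lintegral_gradIntegrand_le {wmin wmax T ω : ℝ} {g h : ℝ → ℝ → ℝ → ℝ → ℝ}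
    {A B : ℝ≥0∞} (hω : 0 < ω) (hω' : ω ≤ wmax)
    (hg : IsDensity wmin wmax T g) (hh : IsDensity wmin wmax T h)
    (hhB : ∀ᵐ m ∂(volume.restrict (Ioo (0 : ℝ) 1)), ∀ᵐ t, t ∈ Ioo 0 T → ‖h t 1 (-m) ω‖ₑ ≤ B)
    (hgA : ∀ᵐ m ∂(volume.restrict (Ioo (0 : ℝ) 1)), ∀ᵐ t, t ∈ Ioo 0 T → ‖g t 1 m ω‖ₑ ≤ A) :
    ∫⁻ p, ‖gradIntegrand g h ω p‖ₑ ∂gradMeasure T ≤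
      ENNReal.ofReal (Real.exp wmax) * (B * (ENNReal.ofReal wmax * (A * ENNReal.ofReal T))) := by
  have hz : IsDensity wmin wmax T fun _ _ _ _ => 0 := ⟨measurable_const, integrable_zero _ _ _⟩
  -- The second pair is zero. No bound on the adjoint difference is needed: `B' = ∞` is multiplied
  -- by `A = 0`, and `0 * ∞ = 0`.
  have := lintegral_gradIntegrand_sub_le (A := 0) (B := B) (B' := ∞)
    (A' := ENNReal.ofReal wmax * (A * ENNReal.ofReal T)) hω hω' hg hz hh hz hhB (by simp) (by
      filter_upwards [hgA, ae_restrict_mem measurableSet_Ioo] with m h1 hm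
      have h2 : ∫⁻ t in Ioo 0 T, ‖g t 1 m ω - 0‖ₑ ≤ A * ENNReal.ofReal T := by
        refine (lintegral_mono_ae (g := fun _ => A)
          ((ae_restrict_iff' measurableSet_Ioo).2 ?_)).trans (by simp)
        filter_upwards [h1] with t ht hT
        rw [sub_zero]
        exact ht hT
      gcongr
      nlinarith [hm.1, hm.2]) (by simp)
  simpa [gradIntegrand] using this

theorem aestronglyMeasurable_gradient {wmin wmax T : ℝ} {g h : ℝ → ℝ → ℝ → ℝ → ℝ}
    (hg : IsDensity wmin wmax T g) (hh : IsDensity wmin wmax T h) :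
    AEStronglyMeasurable (gradient wmin wmax T g h) (freqMeasure wmin wmax) := by
  have : SFinite (gradMeasure T) := by unfold gradMeasure; infer_instance
  exact ((StronglyMeasurable.integral_prod_right' (ν := gradMeasure T)
    (measurable_gradIntegrand hg hh).stronglyMeasurable).const_mul _).aestronglyMeasurable

theorem gradientWellDefined_of_bounded {wmin wmax T : ℝ} (hwmin : 0 ≤ wmin)
    {g h : ℝ → ℝ → ℝ → ℝ → ℝ} {A B : ℝ≥0∞} (hA : A ≠ ∞) (hB : B ≠ ∞)
    (hg : IsDensity wmin wmax T g) (hh : IsDensity wmin wmax T h)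
    (hhB : ∀ᵐ p ∂posVelMeasure wmin wmax, ∀ᵐ t, t ∈ Ioo 0 T → ‖h t 1 (-p.1) p.2‖ₑ ≤ B)
    (hgA : ∀ᵐ p ∂posVelMeasure wmin wmax, ∀ᵐ t, t ∈ Ioo 0 T → ‖g t 1 p.1 p.2‖ₑ ≤ A) :
    GradientWellDefined wmin wmax T g h := by
  have key : ∀ᵐ ω ∂freqMeasure wmin wmax, ∫⁻ p, ‖gradIntegrand g h ω p‖ₑ ∂gradMeasure T ≤
      ENNReal.ofReal (Real.exp wmax) *
        (B * (ENNReal.ofReal wmax * (A * ENNReal.ofReal T))) := by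
    filter_upwards [ae_ae_swap_of_ae_prod hhB, ae_ae_swap_of_ae_prod hgA,
      (ae_restrict_mem measurableSet_Ioo : ∀ᵐ ω ∂freqMeasure wmin wmax, ω ∈ Ioo wmin wmax)]
      with ω h1 h2 hω
    exact lintegral_gradIntegrand_le (hwmin.trans_lt hω.1) hω.2.le hg hh h1 h2
  set Q := ENNReal.ofReal (Real.exp wmax) *
        (B * (ENNReal.ofReal wmax * (A * ENNReal.ofReal T))) with hQ
  have hQt : Q ≠ ∞ := by rw [hQ]; finiteness
  refine ⟨key.mono fun ω hω => ⟨?_, hω.trans_lt hQt.lt_top⟩,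
    aestronglyMeasurable_gradient hg hh, ?_⟩
  · exact ((measurable_gradIntegrand hg hh).comp measurable_prodMk_left).aestronglyMeasurable
  · refine (eLpNorm_le_of_ae_enorm_bound (C := ‖1 / wgStar wmin wmax‖ₑ * Q)
      (key.mono fun ω hω => ?_)).trans_lt ?_
    · unfold gradient
      rw [enorm_mul]
      gcongr
      exact (enorm_integral_le_lintegral_enorm _).trans hω
    · rw [smul_eq_mul]
      refine ENNReal.mul_lt_top (ENNReal.mul_lt_top enorm_lt_top hQt.lt_top) ?_
      exact ENNReal.rpow_lt_top_of_nonneg (by positivity) (measure_ne_top _ _)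

theorem eLpNorm_gradient_sub_le {wmin wmax T : ℝ} (hwmin : 0 ≤ wmin)
    {g₁ g₂ h₁ h₂ : ℝ → ℝ → ℝ → ℝ → ℝ} {A B A' B' : ℝ≥0∞}
    (hg₁ : IsDensity wmin wmax T g₁) (hg₂ : IsDensity wmin wmax T g₂)
    (hh₁ : IsDensity wmin wmax T h₁) (hh₂ : IsDensity wmin wmax T h₂)
    (hw₁ : GradientWellDefined wmin wmax T g₁ h₁) (hw₂ : GradientWellDefined wmin wmax T g₂ h₂)
    (hh : ∀ᵐ p ∂posVelMeasure wmin wmax, ∀ᵐ t, t ∈ Ioo 0 T → ‖h₁ t 1 (-p.1) p.2‖ₑ ≤ B)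
    (hg : ∀ᵐ p ∂posVelMeasure wmin wmax, ∀ᵐ t, t ∈ Ioo 0 T → ‖g₂ t 1 p.1 p.2‖ₑ ≤ A)
    (hg' : ∀ᵐ p ∂posVelMeasure wmin wmax, ENNReal.ofReal (p.1 * p.2) *
      ∫⁻ t in Ioo 0 T, ‖g₁ t 1 p.1 p.2 - g₂ t 1 p.1 p.2‖ₑ ≤ A')
    (hh' : ∀ᵐ p ∂posVelMeasure wmin wmax, ENNReal.ofReal (p.1 * p.2) *
      ∫⁻ t in Ioo 0 T, ‖h₁ t 1 (-p.1) p.2 - h₂ t 1 (-p.1) p.2‖ₑ ≤ B') :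
    eLpNorm (fun ω => gradient wmin wmax T g₁ h₁ ω - gradient wmin wmax T g₂ h₂ ω) 2
      (freqMeasure wmin wmax) ≤ ‖1 / wgStar wmin wmax‖ₑ *
        (ENNReal.ofReal (Real.exp wmax) * (B * A' + A * B')) *
          freqMeasure wmin wmax univ ^ (1 / 2 : ℝ) := by
  refine (eLpNorm_le_of_ae_enorm_bound (C := ‖1 / wgStar wmin wmax‖ₑ *
        (ENNReal.ofReal (Real.exp wmax) * (B * A' + A * B'))) ?_).trans (le_of_eq (by simp))
  filter_upwards [ae_ae_swap_of_ae_prod hh, ae_ae_swap_of_ae_prod hg, ae_ae_swap_of_ae_prod hg',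
    ae_ae_swap_of_ae_prod hh', hw₁.1, hw₂.1,
    (ae_restrict_mem measurableSet_Ioo : ∀ᵐ ω ∂freqMeasure wmin wmax, ω ∈ Ioo wmin wmax)]
    with ω a1 a2 a3 a4 i1 i2 hω
  unfold gradient
  rw [← mul_sub, ← integral_sub i1 i2, enorm_mul]
  gcongr
  exact (enorm_integral_le_lintegral_enorm _).trans
    (lintegral_gradIntegrand_sub_le (hwmin.trans_lt hω.1) hω.2.le hg₁ hg₂ hh₁ hh₂ a1 a2 a3 a4)

end PhononTransport

end

/-! ### The Lipschitz estimate. -/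

theorem proposition4p3 (wmin wmax tmax : ℝ) (hwmin : 0 ≤ wmin) (hw : wmin < wmax)
    (ht : 0 < tmax) :
    ∃ L : ℝ → ℝ → ℝ, ∀ (φ : ℝ → ℝ → ℝ → ℝ) (ψ : ℝ → ℝ),
      PhononTransport.IsBoundedInflow wmin wmax tmax φ →
      PhononTransport.IsBoundedTest tmax ψ →
      ∀ η₁ η₂ : ℝ → ℝ,
        PhononTransport.IsReflection wmin wmax η₁ →
        PhononTransport.IsReflection wmin wmax η₂ →
      ∀ g₁ g₂ h₁ h₂ : ℝ → ℝ → ℝ → ℝ → ℝ,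
        PhononTransport.IsForwardSolution wmin wmax tmax η₁ φ g₁ →
        PhononTransport.IsForwardSolution wmin wmax tmax η₂ φ g₂ →
        PhononTransport.IsAdjointSolution wmin wmax tmax η₁ ψ h₁ →
        PhononTransport.IsAdjointSolution wmin wmax tmax η₂ ψ h₂ →
        PhononTransport.GradientWellDefined wmin wmax tmax g₁ h₁ ∧
        PhononTransport.GradientWellDefined wmin wmax tmax g₂ h₂ ∧
        PhononTransport.normL2 wmin wmax
            (fun ω => PhononTransport.gradient wmin wmax tmax g₁ h₁ ω
              - PhononTransport.gradient wmin wmax tmax g₂ h₂ ω)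
          ≤ L (PhononTransport.normInflow wmin wmax tmax φ) (PhononTransport.normTest tmax ψ)
            * PhononTransport.normL2 wmin wmax (fun ω => η₁ ω - η₂ ω) := by
  obtain ⟨C, hC, HF⟩ := PhononTransport.exists_forward_estimates wmin wmax tmax hwmin
  obtain ⟨D, hD, HA⟩ := PhononTransport.exists_adjoint_estimates wmin wmax tmax hwmin
  set ν := PhononTransport.freqMeasure wmin wmax with hν
  set Q : ℝ≥0∞ := ‖1 / PhononTransport.wgStar wmin wmax‖ₑ * ENNReal.ofReal (Real.exp wmax) *
    (2 * (C * D)) * (ν univ ^ (1 / 2 : ℝ) * ν univ ^ (1 / 2 : ℝ)) with hQ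
  have hνt : ν univ ^ (1 / 2 : ℝ) ≠ ∞ :=
    ENNReal.rpow_ne_top_of_nonneg (by positivity) (measure_ne_top _ _)
  have hQt : Q ≠ ∞ := by rw [hQ]; finiteness
  -- The constant is bilinear in the norms of the data. In `Q`, the `2` counts the two terms of the
  -- product rule, and the two square roots of the band's measure come from passing `L^∞` to `L²`
  -- for the gradient and `L²` to `L¹` for `η₁ - η₂`.
  refine ⟨fun a b => Q.toReal * a * b, fun φ ψ hφ hψ η₁ η₂ hη₁ hη₂ g₁ g₂ h₁ h₂ hg₁ hg₂ hh₁ hh₂ => ?_⟩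
  unfold PhononTransport.normInflow PhononTransport.normTest PhononTransport.normL2
  set a := eLpNorm (fun p : ℝ × ℝ × ℝ => φ p.1 p.2.1 p.2.2) ∞
    (PhononTransport.posBdryMeasure wmin wmax tmax) with ha
  set b := eLpNorm ψ ∞ (PhononTransport.timeMeasure tmax) with hb
  have hat : a ≠ ∞ := hφ.2.ne
  have hbt : b ≠ ∞ := hψ.2.ne
  have hφa := PhononTransport.ae_enorm_inflow_le wmin wmax tmax φ
  -- The estimates bound the second solution of a pair, so pairing a solution with itself bounds
  -- `g₁`, and likewise `h₁`.
  have hF1 := HF η₁ η₁ φ g₁ g₁ a hη₁ hη₁ hg₁ hg₁ hφa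
  have hF2 := HF η₁ η₂ φ g₁ g₂ a hη₁ hη₂ hg₁ hg₂ hφa
  have hA1 := HA η₁ η₁ ψ h₁ h₁ hη₁ hη₁ hh₁ hh₁
  have hA2 := HA η₁ η₂ ψ h₁ h₂ hη₁ hη₂ hh₁ hh₂
  have hCa : C * a ≠ ∞ := ENNReal.mul_ne_top hC hat
  have hDb : D * b ≠ ∞ := ENNReal.mul_ne_top hD hbt
  have hw₁ := PhononTransport.gradientWellDefined_of_bounded hwmin hCa hDb hg₁.density hh₁.density
    hA1.1 hF1.1
  have hw₂ := PhononTransport.gradientWellDefined_of_bounded hwmin hCa hDb hg₂.density hh₂.density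
    hA2.1 hF2.1
  refine ⟨hw₁, hw₂, ?_⟩
  have hmain := PhononTransport.eLpNorm_gradient_sub_le hwmin hg₁.density hg₂.density hh₁.density
    hh₂.density hw₁ hw₂ hA1.1 hF2.1 hF2.2 hA2.2
  set N := eLpNorm (fun ω => η₁ ω - η₂ ω) 2 ν with hN
  have hηm : AEStronglyMeasurable (fun ω => η₁ ω - η₂ ω) ν :=
    (hη₁.1.sub hη₂.1).aestronglyMeasurable
  have hNt : N ≠ ∞ := by
    refine ((MemLp.of_bound hηm (p := 2) 1 ?_).2).ne
    filter_upwards [hη₁.2, hη₂.2] with ω h1 h2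
    rw [Real.norm_eq_abs, abs_le]
    exact ⟨by linarith, by linarith⟩
  have h12 : ∫⁻ w, ‖η₁ w - η₂ w‖ₑ ∂ν ≤ N * ν univ ^ (1 / 2 : ℝ) := by
    rw [← eLpNorm_one_eq_lintegral_enorm]
    refine (eLpNorm_le_eLpNorm_mul_rpow_measure_univ (q := 2) (by norm_num) hηm).trans
      (le_of_eq ?_)
    norm_num [hN]
  have hfin : eLpNorm (fun ω => PhononTransport.gradient wmin wmax tmax g₁ h₁ ω -
      PhononTransport.gradient wmin wmax tmax g₂ h₂ ω) 2 ν ≤ Q * a * b * N := by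
    refine hmain.trans ?_
    calc _ ≤ ‖1 / PhononTransport.wgStar wmin wmax‖ₑ * (ENNReal.ofReal (Real.exp wmax) *
          (D * b * (C * a * (N * ν univ ^ (1 / 2 : ℝ))) +
            C * a * (D * b * (N * ν univ ^ (1 / 2 : ℝ))))) * ν univ ^ (1 / 2 : ℝ) := by gcongr
      _ = _ := by rw [hQ]; ring
  have := ENNReal.toReal_mono (by finiteness) hfin
  simpa only [ENNReal.toReal_mul] using this
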